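/- Let $q$ be a prime power and let $m,m_1,m_2$ be positive integers with $m_1\mid m$, $m_2\mid m$, $\gcd(m_1,m_2)=2$, $\gcd(\frac{m_2}{2},q-1)=1$ and $(m_1,m_2)\neq(2,2)$. Let $\mathrm{Tr}_{q^{m_i}/q}$ be the trace from $\mathbb{F}_{q^{m_i}}$ to $\mathbb{F}_q$ and $\mathrm{N}_{q^m/q^{m_i}}$ the norm from $\mathbb{F}_{q^m}$ to $\mathbb{F}_{q^{m_i}}$. Put $$D=\{x\in\mathbb{F}_{q^m}:\mathrm{Tr}_{q^{m_2}/q}(\mathrm{N}_{q^m/q^{m_2}}(x))=0\},\qquad n=|D|,$$ $$\overline{\mathcal{C}_D}=\left\{\left(\mathrm{Tr}_{q^{m_1}/q}(b\,\mathrm{N}_{q^m/q^{m_1}}(x))\right)_{x\in D}+c\mathbf{1}: b\in\mathbb{F}_{q^{m_1}},\ c\in\mathbb{F}_q\right\}\subseteq\mathbb{F}_q^{\,n},$$ where $\mathbf 1$ is the all-one vector. Write $h=\frac{m_1+m_2}{2}$. Then: (1) $n=\frac{(q^{m}-1)(q^{m_{2}}-q)}{q(q^{m_{2}}-1)}+1$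 and $\dim_{\mathbb{F}_q}\overline{\mathcal{C}_D}=m_1+1$. (2) The Hamming weight distribution of $\overline{\mathcal{C}_D}$ is given by the following table (if two rows have the same weight, their frequencies are added): - weight $0$, frequency $1$; - weight $\frac{(q^{m}-1)(q^{m_{2}}-q)}{q(q^{m_{2}}-1)}+1$, frequency $q-1$; - weight $\frac{(q^{m}-1)(q-1)\left(q^{m_{1}-1}(q^{m_{2}-1}-1)-(-1)^{h}(q-1)q^{h-1}\right)}{(q^{m_{1}}-1)(q^{m_{2}}-1)}$, frequency $\frac{q^{m_{1}}-1}{q+1}$; - weight $\frac{(q^{m}-1)(q-1)\left(q^{m_{1}-1}(q^{m_{2}-1}-1)-(-1)^{h+1}(q-1)q^{h-2}\right)}{(q^{m_{1}}-1)(q^{m_{2}}-1)}$, frequency $\frac{q(q^{m_{1}}-1)}{q+1}$; - weight $\frac{(q^{m}-1)\left((q^{m_{2}-1}-1)(q^{m_{1}}-q^{m_{1}-1}-1)+(-1)^{h}(q-1)q^{h-1}\right)}{(q^{m_{1}}-1)(q^{m_{2}}-1)}+1$, frequency $\frac{(q^{m_{1}}-1)(q-1)}{q+1}$; - weight $\frac{(q^{m}-1)\left((q^{m_{2}-1}-1)(q^{m_{1}}-q^{m_{1}-1}-1)+(-1)^{h+1}(q-1)q^{h-2}\right)}{(q^{m_{1}}-1)(q^{m_{2}}-1)}+1$,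 frequency $\frac{q(q^{m_{1}}-1)(q-1)}{q+1}$. If $m\neq 4$, then $\overline{\mathcal{C}_D}$ is a five-weight code, i.e. exactly five nonzero weights occur. (3) If $m=m_1$, $m_2=2$ and $q>2$, then the dual code $\overline{\mathcal{C}_D}^{\perp}$ has minimum distance $3$. (4) If $m=m_1>4$, $m_2=2$ and $q=2$, then $\overline{\mathcal{C}_D}^{\perp}$ has minimum distance $4$ and is distance-optimal according to the sphere-packing bound: with $k=\dim\overline{\mathcal{C}_D}^{\perp}$, the parameters $[n,k,5]$ violate the sphere-packing bound $2^k\sum_{i=0}^{\lfloor (d-1)/2\rfloor}\binom{n}{i}\le 2^n$ (for $d=5$), and no binary linear $[n,k,5]$ code exists. (5) If $q$ is odd, $m_1\ge 2$, $m_2\geq 2$ and $m_1+m_2\ge 6$, then $\overline{\mathcal{C}_D}$ is $q$-divisible (every weight is divisible by $q$) and self-orthogonal ($\overline{\mathcal{C}_D}\subseteq\overline{\mathcal{C}_D}^{\perp}$). -/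

import Mathlib

/-! ## Linear codes, coordinates indexed by a finite type `ι` -/

section LinearCodes

variable {F ι : Type*} [Field F] [DecidableEq F] [Fintype ι]

/-- `A_w`: the number of codewords of Hamming weight `w` in the code `C`. -/
noncomputable def weightCount (C : Submodule F (ι → F)) (w : ℕ) : ℕ :=
  {c : ι → F | c ∈ C ∧ hammingNorm c = w}.ncard

/-- `C` is a `t`-weight code: exactly `t` nonzero weights occur. -/
def IsWeightCode (C : Submodule F (ι → F)) (t : ℕ) : Prop :=
  {w : ℕ | w ≠ 0 ∧ weightCount C w ≠ 0}.ncard = t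

/-- `d` is the minimum (Hamming) distance of `C`; it fails for every `d` if `C` has only one
codeword. -/
def HasMinDist (C : Submodule F (ι → F)) (d : ℕ) : Prop :=
  IsLeast {r : ℕ | ∃ u ∈ C, ∃ v ∈ C, u ≠ v ∧ hammingDist u v = r} d

/-- The dual code with respect to the standard inner product. -/
def dualCode {F ι : Type*} [Field F] [Fintype ι] (C : Submodule F (ι → F)) :
    Submodule F (ι → F) where
  carrier := {u | ∀ v ∈ C, ∑ i, u i * v i = 0}
  zero_mem' := by intro v _; simp
  add_mem' := by
    intro a b ha hb v hv
    simp [add_mul, Finset.sum_add_distrib, ha v hv, hb v hv]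
  smul_mem' := by
    intro r a ha v hv
    simp [mul_assoc, ← Finset.mul_sum, ha v hv]

/-- Self-orthogonality: `C ⊆ C^⊥`. -/
def IsSelfOrthogonalCode {F ι : Type*} [Field F] [Fintype ι] (C : Submodule F (ι → F)) : Prop :=
  C ≤ dualCode C

/-- All weights of `C` are divisible by `Δ > 1`. -/
def IsDivisibleCode (C : Submodule F (ι → F)) (Δ : ℕ) : Prop :=
  1 < Δ ∧ ∀ c ∈ C, Δ ∣ hammingNorm c

/-- An `[n, k, d]` code is distance-optimal if there is no `[n, k, d + 1]` linear code over the same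
field. -/
def IsDistanceOptimal (C : Submodule F (ι → F)) : Prop :=
  ∃ d : ℕ, HasMinDist C d ∧
    ¬ ∃ C' : Submodule F (ι → F),
      Module.finrank F C' = Module.finrank F C ∧ HasMinDist C' (d + 1)

/-- The sphere-packing inequality
`q ^ k * ∑_{i ≤ ⌊(d - 1) / 2⌋} (n choose i) (q - 1) ^ i ≤ q ^ n` for the parameters `[n, k, d]`. -/
def SpherePackingBound (q n k d : ℕ) : Prop :=
  q ^ k * ∑ i ∈ Finset.range ((d - 1) / 2 + 1), n.choose i * (q - 1) ^ i ≤ q ^ n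

/-- Distance-optimality according to the sphere-packing bound: `C` is distance-optimal, and the
parameters `[n, k, d + 1]` violate the sphere-packing bound (`q` is the size of the field). -/
def IsSpherePackingDistanceOptimal (C : Submodule F (ι → F)) : Prop :=
  IsDistanceOptimal C ∧
    ∃ d : ℕ, HasMinDist C d ∧
      ¬ SpherePackingBound (Nat.card F) (Fintype.card ι) (Module.finrank F C) (d + 1)

end LinearCodes

/-! ## The code built from trace and norm

Here `F = 𝔽_q`, `K₁ = 𝔽_{q^{m₁}}`, `K₂ = 𝔽_{q^{m₂}}` and `L = 𝔽_{q^m}`. -/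

/-- The defining set `D = {x ∈ L : Tr_{K₂/F} (N_{L/K₂} x) = 0}`. -/
noncomputable def definingSet (F K₂ L : Type*) [Field F] [DecidableEq F] [Field K₂] [Field L]
    [Fintype L] [Algebra F K₂] [Algebra K₂ L] : Finset L :=
  Finset.univ.filter fun x => Algebra.trace F K₂ (Algebra.norm K₂ x) = 0

/-- The encoding `(b, c) ↦ (Tr_{K₁/F} (b * N_{L/K₁} x))_{x ∈ D} + c • 1`. -/
noncomputable def augmentedEncoder (F K₁ K₂ L : Type*) [Field F] [DecidableEq F] [Field K₁]
    [Field K₂] [Field L] [Fintype L] [Algebra F K₁] [Algebra F K₂] [Algebra K₁ L]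
    [Algebra K₂ L] : (K₁ × F) →ₗ[F] (definingSet F K₂ L → F) where
  toFun p := fun x => Algebra.trace F K₁ (p.1 * Algebra.norm K₁ (x : L)) + p.2
  map_add' p p' := by
    funext x
    simp only [Prod.fst_add, Prod.snd_add, add_mul, map_add, Pi.add_apply]
    ring
  map_smul' r p := by
    funext x
    simp [mul_add]

/-- The augmented code: all words `(Tr_{K₁/F} (b * N_{L/K₁} x))_{x ∈ D} + c • 1` with
`b ∈ K₁`, `c ∈ F`. -/
noncomputable def augmentedCode (F K₁ K₂ L : Type*) [Field F] [DecidableEq F] [Field K₁]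
    [Field K₂] [Field L] [Fintype L] [Algebra F K₁] [Algebra F K₂] [Algebra K₁ L]
    [Algebra K₂ L] : Submodule F (definingSet F K₂ L → F) :=
  LinearMap.range (augmentedEncoder F K₁ K₂ L)

/-! ## The weight table -/

/-- The weights in the six rows of the table (`q` is the field size; `m₁`, `m₂` are even with
`m₁ + m₂ ≥ 6` wherever it is used, so that the exponents are genuine). -/
def tableWeight (q : ℚ) (m m₁ m₂ : ℕ) : Fin 6 → ℚ :=
  ![0,
    (q ^ m - 1) * (q ^ m₂ - q) / (q * (q ^ m₂ - 1)) + 1,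
    (q ^ m - 1) * (q - 1) *
        (q ^ (m₁ - 1) * (q ^ (m₂ - 1) - 1)
          - (-1) ^ ((m₁ + m₂) / 2) * (q - 1) * q ^ ((m₁ + m₂) / 2 - 1))
      / ((q ^ m₁ - 1) * (q ^ m₂ - 1)),
    (q ^ m - 1) * (q - 1) *
        (q ^ (m₁ - 1) * (q ^ (m₂ - 1) - 1)
          - (-1) ^ ((m₁ + m₂) / 2 + 1) * (q - 1) * q ^ ((m₁ + m₂) / 2 - 2))
      / ((q ^ m₁ - 1) * (q ^ m₂ - 1)),
    (q ^ m - 1) *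
        ((q ^ (m₂ - 1) - 1) * (q ^ m₁ - q ^ (m₁ - 1) - 1)
          + (-1) ^ ((m₁ + m₂) / 2) * (q - 1) * q ^ ((m₁ + m₂) / 2 - 1))
      / ((q ^ m₁ - 1) * (q ^ m₂ - 1)) + 1,
    (q ^ m - 1) *
        ((q ^ (m₂ - 1) - 1) * (q ^ m₁ - q ^ (m₁ - 1) - 1)
          + (-1) ^ ((m₁ + m₂) / 2 + 1) * (q - 1) * q ^ ((m₁ + m₂) / 2 - 2))
      / ((q ^ m₁ - 1) * (q ^ m₂ - 1)) + 1]

/-- The frequencies in the six rows of the table. -/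
def tableFreq (q : ℚ) (m₁ : ℕ) : Fin 6 → ℚ :=
  ![1,
    q - 1,
    (q ^ m₁ - 1) / (q + 1),
    q * (q ^ m₁ - 1) / (q + 1),
    (q ^ m₁ - 1) * (q - 1) / (q + 1),
    q * (q ^ m₁ - 1) * (q - 1) / (q + 1)]

/-! ## Fibres of homomorphisms of finite groups -/

/-! The zeros of the word of `(b, c)` are the `x ∈ D` with `Tr (b * N₁ x) = -c`, so everything rests
on the joint distribution of `Tr (N₂ x)` and `Tr (b * N₁ x)` over `Lˣ`. This is found without
character sums.

Decoupling. The condition `Tr (N₂ x) = 0` is stable under `u` with `N₂ u ∈ F`, and `Tr (b * N₁ x) =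
t` is stable under `ker N₁`. The two gcd hypotheses make every `(q + 1)`-th power a product of two
such elements (`exists_pow_decomposition`). So on each coset of `(q + 1)`-th powers the conditions
are independent, and only their averages there matter (`card_sq_mul_sum_mul_of_pow_decomposition`).

Averages. Since norms are surjective, such an average counts `z` with `Tr (c * z ^ (q + 1)) = t` in
`K₁` or `K₂`. With `S` the number of zeros minus the number of ones, a second moment gives `S ^ 2 =
|radical| * |K|`, and `S ≡ 1` modulo `q + 1` fixes the sign (`hermitianCount_sub_eq`).

Each average singles out one of the `q + 1` cosets; the joint count depends only on whether the two
coincide, which is a condition on the class of `b`. Hence two fibre sizes `V₁`, `V₀`, and the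
weights `0`, `n`, `(q - 1) V_A`, `n - V_A`. Distinctness reduces to `(q - 1) V_A + V_B ≠ n`, a size
estimate followed by a congruence modulo `q`. Divisibility of `n` and `V_A` by `q` gives
self-orthogonality by polarisation. When `K₁ = L` the dual code is the space of affine dependencies
of `D`, a set closed under scaling; in the binary case parity and sphere packing do the rest. -/

theorem card_mul_card_fiber_of_surjective {G H : Type*} [Group G] [Fintype G] [Group H] [Fintype H]
    [DecidableEq H] (φ : G →* H) (hφ : Function.Surjective φ) (h : H) :
    Fintype.card H * (Finset.univ.filter fun g => φ g = h).card = Fintype.card G := by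
  have key := Finset.card_eq_sum_card_fiberwise (f := φ) (s := Finset.univ) (t := Finset.univ)
    (fun _ _ => Finset.mem_coe.2 (Finset.mem_univ _))
  rw [Finset.card_univ] at key
  rw [key, Finset.sum_congr rfl (fun x _ =>
    MonoidHom.card_fiber_eq_of_mem_range φ (hφ x) (hφ h)), Finset.sum_const, Finset.card_univ,
    smul_eq_mul]

theorem card_mul_sum_comp_of_surjective {G H : Type*} [Group G] [Fintype G] [Group H] [Fintype H]
    (φ : G →* H) (hφ : Function.Surjective φ) (f : H → ℚ) :
    (Fintype.card H : ℚ) * ∑ g, f (φ g) = Fintype.card G * ∑ h, f h := by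
  classical
  rw [← Finset.sum_fiberwise_of_maps_to (s := Finset.univ) (t := Finset.univ) (g := φ)
    (fun _ _ => Finset.mem_univ _), Finset.mul_sum, Finset.mul_sum]
  refine Finset.sum_congr rfl fun h _ => ?_
  rw [Finset.sum_congr rfl (g := fun _ => f h) (fun g hg => by rw [(Finset.mem_filter.1 hg).2]),
    Finset.sum_const, nsmul_eq_mul, ← mul_assoc, ← card_mul_card_fiber_of_surjective φ hφ h]
  push_cast; ring

/-- The `d`-th powers lie in the kernel of the power map with exponent `|G| / d`, and in a cyclic
group both subgroups have order `|G| / d`. -/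
theorem IsCyclic.exists_pow_eq_iff {G : Type*} [CommGroup G] [IsCyclic G] [Finite G] {d : ℕ}
    (hd : d ∣ Nat.card G) (a : G) : (∃ z : G, z ^ d = a) ↔ a ^ (Nat.card G / d) = 1 := by
  have hle : (powMonoidHom d : G →* G).range ≤ (powMonoidHom (Nat.card G / d) : G →* G).ker := by
    rintro _ ⟨z, rfl⟩
    simp [MonoidHom.mem_ker, ← pow_mul, Nat.mul_div_cancel' hd]
  have hpos : 0 < Nat.card G := Nat.card_pos
  have heq := Subgroup.eq_of_le_of_card_ge hle (by
    rw [IsCyclic.card_powMonoidHom_range, IsCyclic.card_powMonoidHom_ker,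
      Nat.gcd_eq_right hd, Nat.gcd_eq_right (Nat.div_dvd_of_dvd hd)])
  have := SetLike.ext_iff.1 heq a
  simpa [MonoidHom.mem_ker] using this

theorem IsCyclic.card_pow_eq {G : Type*} [CommGroup G] [IsCyclic G] [Fintype G] [DecidableEq G]
    {d : ℕ} (hd : d ∣ Nat.card G) (a : G) :
    (Finset.univ.filter fun z : G => z ^ d = a).card
      = if a ^ (Nat.card G / d) = 1 then d else 0 := by
  split_ifs with h
  · obtain ⟨z, hz⟩ := (IsCyclic.exists_pow_eq_iff hd a).2 h
    have h1 := MonoidHom.card_fiber_eq_of_mem_range (powMonoidHom d : G →* G) (x := a) (y := 1)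
      ⟨z, hz⟩ ⟨1, by simp⟩
    have h2 := IsCyclic.card_powMonoidHom_ker G d
    rw [Nat.gcd_eq_right hd] at h2
    simp only [powMonoidHom_apply] at h1
    refine h1.trans (Eq.trans ?_ h2)
    rw [Nat.card_eq_fintype_card, Fintype.card_of_subtype]
    simp [MonoidHom.mem_ker]
  · rw [Finset.card_eq_zero, Finset.filter_eq_empty_iff]
    intro z _ hz
    exact h ((IsCyclic.exists_pow_eq_iff hd a).1 ⟨z, hz⟩)

/-- Two functions that are jointly decoupled by the subgroup of `d`-th powers are uncorrelated on
the cosets of that subgroup. -/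
theorem card_sq_mul_sum_mul_of_pow_decomposition {G : Type*} [CommGroup G] [Fintype G] (d : ℕ)
    (f₁ f₂ : G → ℚ)
    (hd : ∀ z : G, ∃ u v : G, z ^ d = u * v ∧ (∀ x, f₁ (x * v) = f₁ x) ∧ ∀ x, f₂ (x * u) = f₂ x) :
    (Fintype.card G : ℚ) ^ 2 * ∑ x, f₁ x * f₂ x
      = ∑ x, (∑ z, f₁ (x * z ^ d)) * ∑ w, f₂ (x * w ^ d) := by
  -- Translating `x` by `v` does not change `f₁`, and the remaining factor `u` is invisible to `f₂`.
  have key : ∀ z : G, ∑ x, f₁ x * f₂ (x * z ^ d) = ∑ x, f₁ x * f₂ x := by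
    intro z
    obtain ⟨u, v, h, h1, h2⟩ := hd z
    rw [h, ← Equiv.sum_comp (Equiv.mulRight v) (fun x => f₁ x * f₂ x)]
    refine Finset.sum_congr rfl fun x _ => ?_
    simp only [Equiv.coe_mulRight, h1]
    rw [← h2 (x * v), mul_comm u v, mul_assoc]
  have step : ∀ z w : G, ∑ x, f₁ (x * z ^ d) * f₂ (x * w ^ d) = ∑ x, f₁ x * f₂ x := by
    intro z w
    rw [← key (w * z⁻¹), ← Equiv.sum_comp (Equiv.mulRight (z ^ d))
      (fun x => f₁ x * f₂ (x * (w * z⁻¹) ^ d))]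
    refine Finset.sum_congr rfl fun x _ => ?_
    simp only [Equiv.coe_mulRight]
    congr 2
    rw [mul_pow, inv_pow, mul_assoc, mul_comm (w ^ d), mul_inv_cancel_left]
  simp_rw [Finset.sum_mul_sum]
  rw [Finset.sum_comm]
  simp_rw [Finset.sum_comm (s := Finset.univ (α := G)) (t := Finset.univ (α := G))
    (f := fun x w => f₁ (x * _ ^ d) * f₂ (x * w ^ d)), step]
  simp [Finset.card_univ, sq, mul_assoc]

/-! ## The form `z ↦ Tr (c * z ^ (q + 1))` on an even-degree extension of `𝔽_q` -/

section HermitianForm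

variable {F K : Type*} [Field F] [Fintype F] [Field K] [Fintype K] [Algebra F K]

theorem pow_card_add (x y : K) :
    (x + y) ^ Fintype.card F = x ^ Fintype.card F + y ^ Fintype.card F := by
  have h := map_add (FiniteField.frobeniusAlgEquivOfAlgebraic F K) x y
  simpa only [FiniteField.coe_frobeniusAlgEquivOfAlgebraic] using h

theorem neg_pow_card (x : K) : (-x) ^ Fintype.card F = -x ^ Fintype.card F := by
  have h := map_neg (FiniteField.frobeniusAlgEquivOfAlgebraic F K) x
  simpa only [FiniteField.coe_frobeniusAlgEquivOfAlgebraic] using h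

theorem trace_pow_card (x : K) :
    Algebra.trace F K (x ^ Fintype.card F) = Algebra.trace F K x := by
  have h := Algebra.trace_eq_of_algEquiv (FiniteField.frobeniusAlgEquivOfAlgebraic F K) x
  simpa only [FiniteField.coe_frobeniusAlgEquivOfAlgebraic] using h

theorem pow_card_bijective : Function.Bijective fun x : K => x ^ Fintype.card F := by
  have h := (FiniteField.frobeniusAlgEquivOfAlgebraic F K).bijective
  simpa only [FiniteField.coe_frobeniusAlgEquivOfAlgebraic] using h

variable (F K) in
theorem fintypeCard_eq_pow_finrank : Fintype.card K = Fintype.card F ^ Module.finrank F K :=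
  Module.card_eq_pow_finrank

theorem card_mul_card_trace_fiber [DecidableEq F] (t : F) :
    Fintype.card F * (Finset.univ.filter fun x : K => Algebra.trace F K x = t).card
      = Fintype.card K := by
  have key := Finset.card_eq_sum_card_fiberwise (f := Algebra.trace F K) (s := Finset.univ)
    (t := Finset.univ) (fun _ _ => Finset.mem_coe.2 (Finset.mem_univ _))
  rw [Finset.card_univ] at key
  rw [key, Finset.sum_congr rfl (fun x _ =>
    AddMonoidHom.card_fiber_eq_of_mem_range (Algebra.trace F K) (Algebra.trace_surjective F K x)
      (Algebra.trace_surjective F K t)), Finset.sum_const, Finset.card_univ, smul_eq_mul]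

variable (F) in
-- Frobenius commutes with negation and fixes `1`, so odd and even characteristic need no separate
-- treatment.
theorem neg_one_pow_card_pow (i : ℕ) : (-1 : K) ^ Fintype.card F ^ i = -1 := by
  induction i with
  | zero => simp
  | succ i ih => rw [pow_succ, pow_mul, ih, neg_pow_card, one_pow]

variable (F K) in
theorem neg_one_pow_geomSum (k : ℕ) :
    (-1 : K) ^ (∑ i ∈ Finset.range k, (Fintype.card F ^ 2) ^ i) = (-1) ^ k := by
  rw [← Finset.prod_pow_eq_pow_sum]
  simp_rw [← pow_mul, neg_one_pow_card_pow F]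
  simp

variable (F K) in
theorem neg_one_pow_card_add_one : (-1 : K) ^ (Fintype.card F + 1) = 1 := by
  have h := neg_one_pow_card_pow F (K := K) 1
  rw [pow_one] at h
  rw [pow_succ, h]; simp

end HermitianForm

/-! ### Factorisation of `q ^ (2 * k) - 1` -/

theorem sq_sub_one_mul_geomSum (q k : ℕ) (hq : 0 < q) :
    (q - 1) * (q + 1) * ∑ i ∈ Finset.range k, (q ^ 2) ^ i = q ^ (2 * k) - 1 := by
  have h1 : 1 ≤ q ^ (2 * k) := Nat.one_le_pow _ _ hq
  zify [hq, h1]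
  have := mul_geom_sum ((q : ℤ) ^ 2) k
  rw [pow_mul, ← this]; ring

theorem pow_two_mul_sub_one_div_add_one (q k : ℕ) (hq : 0 < q) :
    (q ^ (2 * k) - 1) / (q + 1) = (q - 1) * ∑ i ∈ Finset.range k, (q ^ 2) ^ i := by
  rw [← sq_sub_one_mul_geomSum q k hq, mul_assoc, mul_left_comm,
    Nat.mul_div_cancel_left _ (Nat.succ_pos q)]

theorem add_one_dvd_pow_two_mul_sub_one (q k : ℕ) (hq : 0 < q) : q + 1 ∣ q ^ (2 * k) - 1 := by
  rw [← sq_sub_one_mul_geomSum q k hq, mul_assoc, mul_left_comm]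
  exact dvd_mul_right _ _

/-! ### Value distribution of the form -/

section HermitianForm

variable {F K : Type*} [Field F] [Fintype F] [Field K] [Fintype K] [Algebra F K]

/-- Of the two cross terms, `c * w * v ^ q` is raised to the power `q` under the trace; both then
become linear in `w ^ q`. The resulting coefficient vanishes exactly on the radical. -/
theorem trace_hermitian_add (c w v : K) :
    Algebra.trace F K (c * (w + v) ^ (Fintype.card F + 1))
      = Algebra.trace F K (c * w ^ (Fintype.card F + 1))
        + Algebra.trace F K (w ^ Fintype.card F *
            (c * v + c ^ Fintype.card F * v ^ (Fintype.card F ^ 2)))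
        + Algebra.trace F K (c * v ^ (Fintype.card F + 1)) := by
  set q := Fintype.card F with hqdef
  have h1 : c * (w + v) ^ (q + 1)
      = c * w ^ (q + 1) + (w ^ q * (c * v)) + c * w * v ^ q + c * v ^ (q + 1) := by
    rw [pow_succ, hqdef, pow_card_add]; ring
  have h2 : Algebra.trace F K (c * w * v ^ q)
      = Algebra.trace F K (w ^ q * (c ^ q * v ^ (q ^ 2))) := by
    rw [← trace_pow_card (F := F), ← hqdef]
    congr 1; ring
  rw [h1, map_add, map_add, map_add, h2, mul_add, map_add]; ring

/-- On the radical the form vanishes. -/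
theorem trace_hermitian_eq_zero_of_radical {k : ℕ} (hk : Module.finrank F K = 2 * k) {c v : K}
    (h : c * v + c ^ Fintype.card F * v ^ (Fintype.card F ^ 2) = 0) :
    Algebra.trace F K (c * v ^ (Fintype.card F + 1)) = 0 := by
  set q := Fintype.card F with hqdef
  set y := c * v ^ (q + 1) with hy
  -- The radical equation multiplied by `v ^ q`. The conjugates of `y` therefore alternate in sign,
  -- and the `2 * k` of them cancel in the trace.
  have hyq : y ^ q = -y := by
    have : y ^ q + y = v ^ q * (c * v + c ^ q * v ^ (q ^ 2)) := by rw [hy]; ring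
    rw [h, mul_zero] at this
    exact eq_neg_of_add_eq_zero_left this
  have hyi : ∀ i, y ^ q ^ i = (-1) ^ i * y := by
    intro i
    induction i with
    | zero => simp
    | succ i ih =>
      rw [pow_succ, pow_mul, ih, mul_pow, hyq, ← pow_mul, mul_comm i, pow_mul, ← pow_one q,
        hqdef, neg_one_pow_card_pow]
      ring
  apply (algebraMap F K).injective
  rw [FiniteField.algebraMap_trace_eq_sum_pow, map_zero, hk, Nat.card_eq_fintype_card, ← hqdef]
  simp_rw [hyi]
  rw [← Finset.sum_mul]
  have : ∀ k : ℕ, ∑ i ∈ Finset.range (2 * k), (-1 : K) ^ i = 0 := by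
    intro k
    induction k with
    | zero => simp
    | succ k ih => rw [Nat.mul_succ, Finset.sum_range_succ, Finset.sum_range_succ, ih]; ring
  rw [this, zero_mul]

/-- The size of the radical of the form. -/
theorem card_hermitian_radical [DecidableEq K] {k : ℕ} (hk : Module.finrank F K = 2 * k) {c : K}
    (hc : c ≠ 0) :
    (Finset.univ.filter fun v : K =>
        c * v + c ^ Fintype.card F * v ^ (Fintype.card F ^ 2) = 0).card
      = if c ^ ((Fintype.card K - 1) / (Fintype.card F + 1)) = (-1) ^ k
        then Fintype.card F ^ 2 else 1 := by
  classical
  set q := Fintype.card F with hqdef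
  have hq1 : 1 < q := Fintype.one_lt_card
  have hK : Fintype.card K = q ^ (2 * k) := by rw [fintypeCard_eq_pow_finrank F K, hk]
  set g := ∑ i ∈ Finset.range k, (q ^ 2) ^ i with hg
  have hNg : (q - 1) * (q + 1) * g = q ^ (2 * k) - 1 := sq_sub_one_mul_geomSum q k (by omega)
  have hU : Nat.card Kˣ = (q - 1) * (q + 1) * g := by
    rw [Nat.card_eq_fintype_card, Fintype.card_units, hK, hNg]
  have hq2 : (q - 1) * (q + 1) = q ^ 2 - 1 := by
    zify [hq1.le, Nat.one_le_pow 2 q (by omega)]; ring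
  set u : Kˣ := Units.mk0 c hc
  -- Dividing by `c * v` turns the equation for nonzero `v` into a pure power equation with exponent
  -- `q ^ 2 - 1` in the cyclic group `Kˣ`.
  have hfil : (Finset.univ.filter fun v : K => c * v + c ^ q * v ^ (q ^ 2) = 0)
      = insert 0 ((Finset.univ.filter fun v : Kˣ => v ^ ((q - 1) * (q + 1))
          = -(u ^ (q - 1))⁻¹).map ⟨Units.val, Units.val_injective⟩) := by
    ext v
    simp only [Finset.mem_filter, Finset.mem_univ, true_and, Finset.mem_insert, Finset.mem_map,
      Function.Embedding.coeFn_mk]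
    rcases eq_or_ne v 0 with rfl | hv
    · simp [show q ≠ 0 by omega]
    · have e : c * v + c ^ q * v ^ (q ^ 2)
          = c * v * (1 + c ^ (q - 1) * v ^ ((q - 1) * (q + 1))) := by
        have a1 : c ^ q = c * c ^ (q - 1) := by rw [← pow_succ']; congr 1; omega
        have a2 : v ^ q ^ 2 = v * v ^ ((q - 1) * (q + 1)) := by
          rw [hq2, ← pow_succ']; congr 1
          have := Nat.one_le_pow 2 q (by omega)
          omega
        rw [a1, a2]; ring
      rw [e]
      constructor
      · intro h
        right
        refine ⟨Units.mk0 v hv, ?_, rfl⟩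
        rcases mul_eq_zero.1 h with h | h
        · exact absurd h (mul_ne_zero hc hv)
        · rw [← mul_left_cancel_iff (a := u ^ (q - 1)), mul_neg, mul_inv_cancel]
          ext
          push_cast
          simp only [u, Units.val_mk0]
          exact eq_neg_of_add_eq_zero_right h
      · rintro (h | ⟨w, hw, rfl⟩)
        · exact absurd h hv
        · rw [← mul_left_cancel_iff (a := u ^ (q - 1)), mul_neg, mul_inv_cancel] at hw
          have := congrArg Units.val hw
          push_cast at this
          simp only [u, Units.val_mk0] at this
          rw [this]; simp
  rw [hfil, Finset.card_insert_of_notMem (by simp), Finset.card_map,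
    IsCyclic.card_pow_eq (by rw [hU]; exact dvd_mul_right _ _), hU,
    Nat.mul_div_cancel_left _ (Nat.mul_pos (by omega) (by omega)), hK,
    pow_two_mul_sub_one_div_add_one q k (by omega), ← hg]
  -- Solvability criterion for the power equation: `g` is the order of `Kˣ` divided by `q ^ 2 - 1`,
  -- and `(-1) ^ g = (-1) ^ k` since `g` is a sum of `k` powers of `q ^ 2`.
  have hiff : (-(u ^ (q - 1))⁻¹) ^ g = 1 ↔ c ^ ((q - 1) * g) = (-1) ^ k := by
    rw [Units.ext_iff]
    push_cast
    simp only [u, Units.val_mk0]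
    rw [neg_pow, hg, hqdef, neg_one_pow_geomSum F K, ← hqdef, ← hg, inv_pow, ← pow_mul,
      mul_inv_eq_one₀ (pow_ne_zero _ hc), eq_comm]
  rw [if_congr hiff rfl rfl]
  split_ifs
  · rw [hq2, Nat.sub_add_cancel (Nat.one_le_pow 2 q (by omega))]
  · rfl

variable [DecidableEq F]

/-- The number of `z` with `Tr (c * z ^ (q + 1)) = t`. -/
noncomputable def hermitianCount (F : Type*) {K : Type*} [Field F] [Fintype F] [DecidableEq F] [Field K]
    [Fintype K] [Algebra F K] (c : K) (t : F) : ℕ :=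
  (Finset.univ.filter fun z : K => Algebra.trace F K (c * z ^ (Fintype.card F + 1)) = t).card

/-- Nonzero values are equidistributed. -/
theorem hermitianCount_eq_of_ne_zero {k : ℕ} (hk : Module.finrank F K = 2 * k) (c : K) {t : F}
    (ht : t ≠ 0) : hermitianCount F c t = hermitianCount F c 1 := by
  classical
  set q := Fintype.card F with hqdef
  have hq1 : 1 < q := Fintype.one_lt_card
  have hK : Fintype.card K = q ^ (2 * k) := by rw [fintypeCard_eq_pow_finrank F K, hk]
  have hU : Nat.card Kˣ = q ^ (2 * k) - 1 := by
    rw [Nat.card_eq_fintype_card, Fintype.card_units, hK]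
  set τ : Kˣ := Units.map (algebraMap F K).toMonoidHom (Units.mk0 t ht)
  -- Elements of `Fˣ` are `(q + 1)`-th powers in `Kˣ`, because `q - 1` divides `|Kˣ| / (q + 1)`.
  -- Scaling `z` by `e` carries the value `1` to `t`.
  obtain ⟨e, he⟩ : ∃ e : Kˣ, e ^ (q + 1) = τ := by
    rw [IsCyclic.exists_pow_eq_iff
      (by rw [hU]; exact add_one_dvd_pow_two_mul_sub_one q k (by omega)), hU,
      pow_two_mul_sub_one_div_add_one q k (by omega), pow_mul]
    have : τ ^ (q - 1) = 1 := by
      rw [← map_pow]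
      have : (Units.mk0 t ht) ^ (q - 1) = 1 := by
        ext; simpa using FiniteField.pow_card_sub_one_eq_one t ht
      rw [this, map_one]
    rw [this, one_pow]
  have heK : (e : K) ^ (q + 1) = algebraMap F K t := by
    have := congrArg Units.val he
    simpa [τ] using this
  unfold hermitianCount
  symm
  refine Finset.card_bij (fun z _ => (e : K) * z) ?_ ?_ ?_
  · intro z hz
    simp only [Finset.mem_filter, Finset.mem_univ, true_and] at hz ⊢
    rw [mul_pow, ← hqdef, heK, mul_left_comm, ← Algebra.smul_def, map_smul, hz, smul_eq_mul, mul_one]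
  · intro a _ b _ h
    exact mul_left_cancel₀ e.ne_zero h
  · intro z hz
    refine ⟨(e⁻¹ : Kˣ) * z, ?_, by simp⟩
    simp only [Finset.mem_filter, Finset.mem_univ, true_and] at hz ⊢
    have h1 : c * z ^ (q + 1) = t • (c * (((e⁻¹ : Kˣ) : K) * z) ^ (q + 1)) := by
      rw [Algebra.smul_def, ← heK, mul_left_comm, ← mul_pow, Units.mul_inv_cancel_left]
    rw [← hqdef, h1, map_smul, smul_eq_mul] at hz
    exact mul_left_cancel₀ ht (hz.trans (mul_one t).symm)

/-- The free function `p` serves both moments: the identity for the first and the square for the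
second. -/
theorem sum_hermitianCount {M : Type*} [CommSemiring M] {k : ℕ} (hk : Module.finrank F K = 2 * k)
    (c : K) (p : ℕ → M) :
    ∑ t : F, p (hermitianCount F c t)
      = p (hermitianCount F c 0) + (Fintype.card F - 1 : ℕ) * p (hermitianCount F c 1) := by
  rw [← Finset.add_sum_erase _ _ (Finset.mem_univ (0 : F)),
    Finset.sum_congr rfl (g := fun _ => p (hermitianCount F c 1))
      (fun t ht => by rw [hermitianCount_eq_of_ne_zero hk c (Finset.ne_of_mem_erase ht)]),
    Finset.sum_const, Finset.card_erase_of_mem (Finset.mem_univ _), Finset.card_univ, nsmul_eq_mul]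

theorem hermitianCount_add {k : ℕ} (hk : Module.finrank F K = 2 * k) (c : K) :
    hermitianCount F c 0 + (Fintype.card F - 1) * hermitianCount F c 1 = Fintype.card K := by
  have h := sum_hermitianCount (M := ℕ) hk c id
  simp only [id, Nat.cast_id] at h
  rw [← h]
  exact (Finset.card_eq_sum_card_fiberwise (fun _ _ => Finset.mem_coe.2 (Finset.mem_univ _))).symm

/-- Both sides count the pairs on which the form agrees; on the right they are sorted by their
difference `v`. -/
theorem sum_sq_hermitianCount (c : K) :
    ∑ t : F, hermitianCount F c t ^ 2 = ∑ v : K, (Finset.univ.filter fun w : K =>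
      Algebra.trace F K (c * (w + v) ^ (Fintype.card F + 1))
        = Algebra.trace F K (c * w ^ (Fintype.card F + 1))).card := by
  classical
  set f : K → F := fun z => Algebra.trace F K (c * z ^ (Fintype.card F + 1)) with hf
  have h1 : ∀ t : F, hermitianCount F c t ^ 2
      = ((Finset.univ (α := K × K)).filter fun p => f p.1 = t ∧ f p.2 = t).card := by
    intro t
    rw [sq, hermitianCount, ← Finset.card_product, ← Finset.univ_product_univ,
      ← Finset.filter_product]
  have h2 : ∑ t : F, hermitianCount F c t ^ 2
      = ((Finset.univ (α := K × K)).filter fun p => f p.1 = f p.2).card := by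
    rw [Finset.card_eq_sum_card_fiberwise (f := fun p : K × K => f p.2) (t := Finset.univ)
      (fun _ _ => Finset.mem_coe.2 (Finset.mem_univ _))]
    refine Finset.sum_congr rfl fun t _ => ?_
    rw [h1, Finset.filter_filter]
    congr 1
    ext p
    simp only [Finset.mem_filter, Finset.mem_univ, true_and]
    constructor
    · rintro ⟨a, b⟩; exact ⟨a.trans b.symm, b⟩
    · rintro ⟨a, b⟩; exact ⟨a.trans b, b⟩
  rw [h2, Finset.card_eq_sum_card_fiberwise (f := fun p : K × K => p.1 - p.2) (t := Finset.univ)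
      (fun _ _ => Finset.mem_coe.2 (Finset.mem_univ _))]
  refine Finset.sum_congr rfl fun v _ => ?_
  refine Finset.card_bij (fun p _ => p.2) ?_ ?_ ?_
  · intro p hp
    simp only [Finset.mem_filter, Finset.mem_univ, true_and] at hp ⊢
    rw [← hp.2, add_sub_cancel]; exact hp.1
  · intro p hp p' hp' h
    simp only [Finset.mem_filter, Finset.mem_univ, true_and] at hp hp' h
    refine Prod.ext ?_ h
    have := hp.2.trans hp'.2.symm
    rw [h] at this
    exact sub_left_injective this
  · intro w hw
    simp only [Finset.mem_filter, Finset.mem_univ, true_and] at hw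
    exact ⟨(w + v, w), by simpa using hw, rfl⟩

/-- The increment of the form along `v` is affine in `w ^ q`. Off the radical its linear part is a
nonzero trace functional, hence equidistributed; on the radical the constant term vanishes as well,
so every `w` qualifies. -/
theorem card_mul_card_hermitian_shift {k : ℕ} (hk : Module.finrank F K = 2 * k) (c v : K)
    [DecidableEq K] :
    Fintype.card F * (Finset.univ.filter fun w : K =>
      Algebra.trace F K (c * (w + v) ^ (Fintype.card F + 1))
        = Algebra.trace F K (c * w ^ (Fintype.card F + 1))).card
      = if c * v + c ^ Fintype.card F * v ^ (Fintype.card F ^ 2) = 0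
        then Fintype.card F * Fintype.card K else Fintype.card K := by
  simp only [trace_hermitian_add]
  split_ifs with h
  · rw [h, trace_hermitian_eq_zero_of_radical hk h]
    simp
  · set l := c * v + c ^ Fintype.card F * v ^ (Fintype.card F ^ 2) with hl
    set t := Algebra.trace F K (c * v ^ (Fintype.card F + 1)) with ht
    rw [← card_mul_card_trace_fiber (F := F) (K := K) (-t)]
    congr 1
    have hb : Function.Bijective fun w : K => w ^ Fintype.card F * l :=
      (Equiv.mulRight₀ l h).bijective.comp pow_card_bijective
    refine Finset.card_bij (fun w _ => w ^ Fintype.card F * l) ?_ ?_ ?_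
    · intro w hw
      simp only [Finset.mem_filter, Finset.mem_univ, true_and] at hw ⊢
      linear_combination hw
    · intro a _ b _ hab
      exact hb.1 hab
    · intro y hy
      obtain ⟨w, rfl⟩ := hb.2 y
      simp only [Finset.mem_filter, Finset.mem_univ, true_and] at hy
      refine ⟨w, ?_, rfl⟩
      simp only [Finset.mem_filter, Finset.mem_univ, true_and]
      linear_combination hy

/-- Let `N = |K|`, let `R` be the size of the radical and `H₀`, `H₁` the two counts. The moments are
`H₀ + (q - 1) H₁ = N` and `q (H₀² + (q - 1) H₁²) = N² + (q - 1) R N`; subtracting the square of the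
first from the second leaves `(H₀ - H₁)² = R N`. -/
theorem sq_hermitianCount_sub [DecidableEq K] {k : ℕ} (hk : Module.finrank F K = 2 * k) {c : K}
    (hc : c ≠ 0) :
    ((hermitianCount F c 0 : ℤ) - hermitianCount F c 1) ^ 2
      = (if c ^ ((Fintype.card K - 1) / (Fintype.card F + 1)) = (-1) ^ k
        then (Fintype.card F : ℤ) ^ 2 else 1) * Fintype.card K := by
  have hq1 : 1 < Fintype.card F := Fintype.one_lt_card
  have h1 := hermitianCount_add hk c
  have h2 := sum_hermitianCount (M := ℕ) hk c (fun n => n ^ 2)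
  rw [sum_sq_hermitianCount] at h2
  have h3 : Fintype.card F * ∑ v : K, (Finset.univ.filter fun w : K =>
      Algebra.trace F K (c * (w + v) ^ (Fintype.card F + 1))
        = Algebra.trace F K (c * w ^ (Fintype.card F + 1))).card
      + (Finset.univ.filter fun v : K =>
        c * v + c ^ Fintype.card F * v ^ (Fintype.card F ^ 2) = 0).card * Fintype.card K
      = (Finset.univ.filter fun v : K =>
        c * v + c ^ Fintype.card F * v ^ (Fintype.card F ^ 2) = 0).card
          * (Fintype.card F * Fintype.card K) + Fintype.card K * Fintype.card K := by
    rw [Finset.mul_sum, Finset.sum_congr rfl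
      (fun v _ => card_mul_card_hermitian_shift hk c v), Finset.sum_ite, Finset.sum_const,
      Finset.sum_const, smul_eq_mul, smul_eq_mul, add_assoc, ← add_mul, add_comm _ (Finset.card _),
      Finset.card_filter_add_card_filter_not, Finset.card_univ]
  rw [h2, card_hermitian_radical hk hc] at h3
  obtain ⟨q', hq'⟩ : ∃ q', Fintype.card F = q' + 2 := ⟨_, (Nat.sub_add_cancel hq1).symm⟩
  have hq0 : (q' : ℤ) + 1 ≠ 0 := by positivity
  rw [hq'] at h1 h3 ⊢
  simp only [Nat.cast_id, show q' + 2 - 1 = q' + 1 by omega] at h1 h3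
  apply mul_left_cancel₀ hq0
  split_ifs at h3 ⊢ <;>
  · zify at h1 h3
    rw [← h1] at h3 ⊢
    push_cast
    linear_combination h3

/-- The sign of the form is determined modulo `q + 1`. -/
theorem add_one_dvd_hermitianCount_sub {k : ℕ} (hk : Module.finrank F K = 2 * k) (c : K) :
    ((Fintype.card F : ℤ) + 1) ∣ (hermitianCount F c 0 : ℤ) - hermitianCount F c 1 - 1 := by
  classical
  set q := Fintype.card F with hqdef
  have hq1 : 1 < q := Fintype.one_lt_card
  have hK : Fintype.card K = q ^ (2 * k) := by rw [fintypeCard_eq_pow_finrank F K, hk]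
  have hU : Nat.card Kˣ = q ^ (2 * k) - 1 := by
    rw [Nat.card_eq_fintype_card, Fintype.card_units, hK]
  -- The value depends on `z ^ (q + 1)` alone, and the fibres of this power map on `Kˣ` have `0` or
  -- `q + 1` elements. The remaining point `z = 0` contributes the residue `1`.
  have key : ∀ t : F, q + 1 ∣ (Finset.univ.filter fun z : Kˣ =>
      Algebra.trace F K (c * (z : K) ^ (q + 1)) = t).card := by
    intro t
    rw [Finset.card_eq_sum_card_fiberwise (f := fun z : Kˣ => z ^ (q + 1)) (t := Finset.univ)
      (fun _ _ => Finset.mem_coe.2 (Finset.mem_univ _))]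
    refine Finset.dvd_sum fun y _ => ?_
    rw [Finset.filter_filter]
    by_cases hy : Algebra.trace F K (c * (y : K)) = t
    · have : (Finset.univ.filter fun z : Kˣ =>
          Algebra.trace F K (c * (z : K) ^ (q + 1)) = t ∧ z ^ (q + 1) = y)
          = Finset.univ.filter fun z : Kˣ => z ^ (q + 1) = y := by
        refine Finset.filter_congr fun z _ => and_iff_right_of_imp ?_
        rintro rfl
        simpa using hy
      rw [this, IsCyclic.card_pow_eq
        (by rw [hU]; exact add_one_dvd_pow_two_mul_sub_one q k (by omega))]
      split_ifs <;> simp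
    · rw [Finset.filter_false_of_mem, Finset.card_empty]
      · exact dvd_zero _
      · rintro z _ ⟨h, rfl⟩
        exact hy (by simpa using h)
  have hsplit : ∀ t : F, hermitianCount F c t = (Finset.univ.filter fun z : Kˣ =>
      Algebra.trace F K (c * (z : K) ^ (q + 1)) = t).card + if t = 0 then 1 else 0 := by
    intro t
    have : (Finset.univ.filter fun z : K => Algebra.trace F K (c * z ^ (q + 1)) = t)
        = (Finset.univ.filter fun z : Kˣ => Algebra.trace F K (c * (z : K) ^ (q + 1)) = t).map
            ⟨Units.val, Units.val_injective⟩ ∪ if t = 0 then {0} else ∅ := by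
      ext z
      simp only [Finset.mem_filter, Finset.mem_univ, true_and, Finset.mem_union, Finset.mem_map,
        Function.Embedding.coeFn_mk]
      rcases eq_or_ne z 0 with rfl | hz
      · split_ifs with h <;> simp [h, eq_comm]
      · constructor
        · intro h; exact Or.inl ⟨Units.mk0 z hz, by simpa using h, rfl⟩
        · rintro (⟨w, hw, rfl⟩ | h)
          · exact hw
          · split_ifs at h <;> simp_all
    rw [hermitianCount, ← hqdef, this, Finset.card_union_of_disjoint, Finset.card_map]
    · split_ifs <;> simp
    · split_ifs <;> simp
  rw [hsplit 0, hsplit 1, if_pos rfl, if_neg one_ne_zero]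
  obtain ⟨a, ha⟩ := key 0
  obtain ⟨b, hb⟩ := key 1
  rw [ha, hb]
  push_cast
  exact ⟨a - b, by ring⟩

/-- The square leaves `± q ^ j` with `j = k` or `j = k + 1`. Modulo `q + 1` both `(-q) ^ j` and the
difference are `1`, and the wrong sign would force `q + 1 ∣ 2`. -/
theorem hermitianCount_sub_eq [DecidableEq K] {k : ℕ} (hk : Module.finrank F K = 2 * k) {c : K}
    (hc : c ≠ 0) :
    (hermitianCount F c 0 : ℤ) - hermitianCount F c 1
      = (-1) ^ k * (Fintype.card F : ℤ) ^ k *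
        (1 - ((Fintype.card F : ℤ) + 1) *
          if c ^ ((Fintype.card K - 1) / (Fintype.card F + 1)) = (-1) ^ k then 1 else 0) := by
  have h1 := sq_hermitianCount_sub hk hc
  have h2 := add_one_dvd_hermitianCount_sub (F := F) hk c
  rw [fintypeCard_eq_pow_finrank F K, hk] at h1 ⊢
  have hq1 : 1 < Fintype.card F := Fintype.one_lt_card
  set q := Fintype.card F with hqdef
  generalize (hermitianCount F c 0 : ℤ) - hermitianCount F c 1 = S at h1 h2 ⊢
  have aux : ∀ j : ℕ, S ^ 2 = ((q : ℤ) ^ j) ^ 2 → S = (-1) ^ j * (q : ℤ) ^ j := by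
    intro j hj
    have hmod : ((q : ℤ) + 1) ∣ (-1) ^ j * (q : ℤ) ^ j - 1 := by
      have := sub_dvd_pow_sub_pow (-(q : ℤ)) 1 j
      rw [one_pow, neg_pow] at this
      refine dvd_trans ?_ this
      exact ⟨-1, by ring⟩
    have hsq : S = (-1) ^ j * (q : ℤ) ^ j ∨ S = -((-1) ^ j * (q : ℤ) ^ j) := by
      apply sq_eq_sq_iff_eq_or_eq_neg.1
      rw [hj, mul_pow, pow_right_comm (-1 : ℤ)]; simp
    rcases hsq with h | h
    · exact h
    · exfalso
      rw [h] at h2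
      have h3 := dvd_add h2 hmod
      have h4 : ((q : ℤ) + 1) ∣ 2 := by
        rw [← dvd_neg]
        convert h3 using 1; ring
      have := Int.le_of_dvd (by norm_num) h4
      omega
  push_cast at h1
  split_ifs at h1 ⊢
  · have := aux (k + 1) (by rw [h1]; ring)
    rw [this]; ring
  · have := aux k (by rw [h1]; ring)
    rw [this]; ring

theorem card_mul_hermitianCount_zero {k : ℕ} (hk : Module.finrank F K = 2 * k) (c : K) :
    (Fintype.card F : ℚ) * hermitianCount F c 0 = (Fintype.card F : ℚ) ^ (2 * k)
      + (Fintype.card F - 1) * ((hermitianCount F c 0 : ℤ) - hermitianCount F c 1 : ℤ) := by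
  have h := hermitianCount_add hk c
  have hq1 : 1 < Fintype.card F := Fintype.one_lt_card
  rw [fintypeCard_eq_pow_finrank F K, hk] at h
  have h' := congrArg (Nat.cast : ℕ → ℚ) h
  push_cast [Nat.cast_sub hq1.le] at h'
  push_cast
  linear_combination h'

theorem card_mul_hermitianCount_of_ne_zero {k : ℕ} (hk : Module.finrank F K = 2 * k) (c : K)
    {t : F} (ht : t ≠ 0) :
    (Fintype.card F : ℚ) * hermitianCount F c t = (Fintype.card F : ℚ) ^ (2 * k)
      - ((hermitianCount F c 0 : ℤ) - hermitianCount F c 1 : ℤ) := by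
  have h := hermitianCount_add hk c
  have hq1 : 1 < Fintype.card F := Fintype.one_lt_card
  rw [fintypeCard_eq_pow_finrank F K, hk] at h
  have h' := congrArg (Nat.cast : ℕ → ℚ) h
  push_cast [Nat.cast_sub hq1.le] at h'
  rw [hermitianCount_eq_of_ne_zero hk c ht]
  push_cast
  linear_combination h'

end HermitianForm

/-! ## Joint distribution of the trace of two norms -/

theorem gcd_geomSum_sub_one (q k : ℕ) (hq : 0 < q) :
    Nat.gcd (∑ i ∈ Finset.range k, (q ^ 2) ^ i) (q - 1) = Nat.gcd k (q - 1) := by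
  apply Nat.ModEq.gcd_eq
  have hq1 : q ≡ 1 [MOD (q - 1)] := by
    have := (Nat.modEq_sub (b := 1) hq)
    exact this
  have h : ∀ k, ∑ i ∈ Finset.range k, (q ^ 2) ^ i ≡ k [MOD (q - 1)] := by
    intro k
    induction k with
    | zero => rfl
    | succ k ih =>
      rw [Finset.sum_range_succ]
      refine ih.add ?_
      simpa using (hq1.pow 2).pow k
  exact h k

/-- Both gcd hypotheses enter here. The first puts the common divisor inside `q ^ 2 - 1 = (q + 1) *
(q - 1)`. The quotient is `(q + 1) * g` with `g ≡ k₂` modulo `q - 1`, so the second removes the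
factor `q - 1`. -/
theorem gcd_card_quotient_dvd {q k₁ k₂ : ℕ} (hq : 1 < q) (he : Nat.gcd (2 * k₁) (2 * k₂) = 2)
    (hl : Nat.gcd k₂ (q - 1) = 1) :
    Nat.gcd ((q ^ (2 * k₂) - 1) / (q - 1)) (q ^ (2 * k₁) - 1) ∣ q + 1 := by
  set g := ∑ i ∈ Finset.range k₂, (q ^ 2) ^ i with hg
  have hNg : (q - 1) * (q + 1) * g = q ^ (2 * k₂) - 1 := sq_sub_one_mul_geomSum q k₂ (by omega)
  have hdiv : (q ^ (2 * k₂) - 1) / (q - 1) = (q + 1) * g := by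
    rw [← hNg, mul_assoc, Nat.mul_div_cancel_left _ (by omega)]
  rw [hdiv]
  set d := Nat.gcd ((q + 1) * g) (q ^ (2 * k₁) - 1)
  have h1 : d ∣ (q + 1) * g := Nat.gcd_dvd_left _ _
  have h2 : d ∣ q ^ (2 * k₁) - 1 := Nat.gcd_dvd_right _ _
  have h3 : d ∣ (q + 1) * (q - 1) := by
    have h4 : d ∣ q ^ (2 * k₂) - 1 := by
      rw [← hNg, mul_assoc]; exact Dvd.dvd.mul_left h1 _
    have := Nat.dvd_gcd h2 h4
    rw [Nat.pow_sub_one_gcd_pow_sub_one, he] at this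
    rwa [← Nat.sq_sub_sq, one_pow]
  have := Nat.dvd_gcd h1 h3
  rwa [Nat.gcd_mul_left, hg, gcd_geomSum_sub_one q k₂ (by omega), hl, mul_one] at this

section TraceNorm

variable {F K L : Type*} [Field F] [Fintype F] [Field K] [Fintype K] [Field L] [Fintype L]
  [Algebra F K] [Algebra K L]

theorem norm_units_ne_zero {K L : Type*} [Field K] [Field L] [Algebra K L] (x : Lˣ) : Algebra.norm K (x : L) ≠ 0 :=
  (x.isUnit.map (Algebra.norm K)).ne_zero

theorem card_sub_one_dvd : Fintype.card K - 1 ∣ Fintype.card L - 1 := by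
  rw [Module.card_eq_pow_finrank (K := K) (V := L)]
  simpa using Nat.sub_dvd_pow_sub_pow (Fintype.card K) 1 (Module.finrank K L)

/-- The norm is a power map. This transports residue conditions on `N₁ x` and `N₂ x` into the common
field `L`, where they can be compared. -/
theorem algebraMap_norm_pow_quotient {d : ℕ} (hd : d ∣ Fintype.card K - 1) (x : L) :
    algebraMap K L (Algebra.norm K x ^ ((Fintype.card K - 1) / d))
      = x ^ ((Fintype.card L - 1) / d) := by
  rw [map_pow, FiniteField.algebraMap_norm_eq_pow, ← pow_mul, Nat.card_eq_fintype_card,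
    Nat.card_eq_fintype_card, 
    mul_comm, Nat.div_mul_div_comm hd card_sub_one_dvd, mul_comm d,
    Nat.mul_div_mul_left _ _ (Nat.sub_pos_of_lt Fintype.one_lt_card)]

variable [DecidableEq L]

theorem card_units_pow_eq {k : ℕ} [Algebra F L] (hk : Module.finrank F L = 2 * k) {ζ : L}
    (hζ : ζ ^ (Fintype.card F + 1) = 1) :
    ((Fintype.card F : ℚ) + 1) * ∑ x : Lˣ,
        (if (x : L) ^ ((Fintype.card L - 1) / (Fintype.card F + 1)) = ζ then (1 : ℚ) else 0)
      = (Fintype.card L : ℚ) - 1 := by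
  classical
  have hdvd : Fintype.card F + 1 ∣ Fintype.card L - 1 := by
    rw [fintypeCard_eq_pow_finrank F L, hk]
    exact add_one_dvd_pow_two_mul_sub_one _ _ Fintype.card_pos
  have hcard : Nat.card Lˣ = Fintype.card L - 1 := by
    rw [Nat.card_eq_fintype_card, Fintype.card_units]
  have hpos : 0 < Fintype.card L - 1 := by
    have := Fintype.one_lt_card (α := L); omega
  obtain ⟨u, rfl⟩ : ∃ u : Lˣ, (u : L) = ζ :=
    ⟨Units.mk0 ζ (by rintro rfl; simp at hζ), rfl⟩
  have hc := IsCyclic.card_pow_eq (G := Lˣ)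
    (d := (Fintype.card L - 1) / (Fintype.card F + 1))
    (by rw [hcard]; exact Nat.div_dvd_of_dvd hdvd) u
  rw [hcard, Nat.div_div_self hdvd hpos.ne', if_pos (by ext; simpa using hζ)] at hc
  rw [Finset.sum_boole]
  have : (Finset.univ.filter fun x : Lˣ =>
      (x : L) ^ ((Fintype.card L - 1) / (Fintype.card F + 1)) = u)
      = Finset.univ.filter fun x : Lˣ =>
        x ^ ((Fintype.card L - 1) / (Fintype.card F + 1)) = u :=
    Finset.filter_congr fun x _ => by rw [Units.ext_iff]; simp
  rw [this, hc]
  have h2 : (((Fintype.card F + 1) * ((Fintype.card L - 1) / (Fintype.card F + 1)) : ℕ) : ℚ)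
      = (Fintype.card L - 1 : ℕ) := by rw [Nat.mul_div_cancel' hdvd]
  rw [Nat.cast_sub Fintype.card_pos] at h2
  push_cast at h2 ⊢
  exact h2

variable [DecidableEq F]

/-- The average over `(q + 1)`-th powers of the indicator of `Tr (b * N x) = t`. -/
theorem sum_units_trace_norm (b : K) (t : F) (x : Lˣ) :
    ((Fintype.card K : ℚ) - 1) * ∑ z : Lˣ,
        (if Algebra.trace F K (b * Algebra.norm K ((x * z ^ (Fintype.card F + 1) : Lˣ) : L)) = t
          then (1 : ℚ) else 0)
      = ((Fintype.card L : ℚ) - 1) * (hermitianCount F (b * Algebra.norm K (x : L)) t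
          - if t = 0 then 1 else 0) := by
  classical
  have hK : ((Fintype.card K : ℚ) - 1) = Fintype.card Kˣ := by
    rw [Fintype.card_units, Nat.cast_sub Fintype.card_pos, Nat.cast_one]
  have hL : ((Fintype.card L : ℚ) - 1) = Fintype.card Lˣ := by
    rw [Fintype.card_units, Nat.cast_sub Fintype.card_pos, Nat.cast_one]
  have h := card_mul_sum_comp_of_surjective (Units.map (Algebra.norm K (S := L)))
    (FiniteField.unitsMap_norm_surjective K L) (fun y : Kˣ =>
      if Algebra.trace F K (b * Algebra.norm K (x : L) * (y : K) ^ (Fintype.card F + 1)) = t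
        then (1 : ℚ) else 0)
  rw [hK, hL]
  convert h using 2
  · refine Finset.sum_congr rfl fun z _ => ?_
    simp [mul_assoc]
  · have : (hermitianCount F (b * Algebra.norm K (x : L)) t : ℚ) = ∑ y : K,
        if Algebra.trace F K (b * Algebra.norm K (x : L) * y ^ (Fintype.card F + 1)) = t
          then (1 : ℚ) else 0 := by
      rw [hermitianCount, Finset.sum_boole]
    rw [this, ← Finset.add_sum_erase _ _ (Finset.mem_univ (0 : K))]
    have h0 : (if Algebra.trace F K (b * Algebra.norm K (x : L) * (0 : K) ^ (Fintype.card F + 1)) = t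
        then (1 : ℚ) else 0) = if t = 0 then 1 else 0 := by
      simp [eq_comm]
    rw [h0, add_sub_cancel_left]
    symm
    refine Finset.sum_bij (fun y _ => (y : K)) (fun y _ => by simp) (fun a _ b _ h => Units.ext h)
      (fun y hy => ⟨Units.mk0 y (Finset.ne_of_mem_erase hy), by simp, rfl⟩) (fun _ _ => rfl)

/-- The norm maps `Lˣ` uniformly onto `Kˣ`, where the trace has `|K| / q - 1` nonzero zeros. -/
theorem card_units_trace_norm_eq_zero :
    (Fintype.card F : ℚ) * ((Fintype.card K : ℚ) - 1)
        * (Finset.univ.filter fun x : Lˣ => Algebra.trace F K (Algebra.norm K (x : L)) = 0).card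
      = ((Fintype.card L : ℚ) - 1) * ((Fintype.card K : ℚ) - Fintype.card F) := by
  classical
  have hK : ((Fintype.card K : ℚ) - 1) = Fintype.card Kˣ := by
    rw [Fintype.card_units, Nat.cast_sub Fintype.card_pos, Nat.cast_one]
  have hL : ((Fintype.card L : ℚ) - 1) = Fintype.card Lˣ := by
    rw [Fintype.card_units, Nat.cast_sub Fintype.card_pos, Nat.cast_one]
  have h := card_mul_sum_comp_of_surjective (Units.map (Algebra.norm K (S := L)))
    (FiniteField.unitsMap_norm_surjective K L) (fun y : Kˣ =>
      if Algebra.trace F K (y : K) = 0 then (1 : ℚ) else 0)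
  have h1 := card_mul_card_trace_fiber (F := F) (K := K) 0
  have h2 : ((Finset.univ.filter fun x : K => Algebra.trace F K x = 0).card : ℚ)
      = (∑ y : Kˣ, if Algebra.trace F K (y : K) = 0 then (1 : ℚ) else 0) + 1 := by
    rw [← Finset.sum_boole, ← Finset.add_sum_erase _ _ (Finset.mem_univ (0 : K)), map_zero,
      if_pos rfl, add_comm]
    congr 1
    symm
    refine Finset.sum_bij (fun y _ => (y : K)) (fun y _ => by simp) (fun a _ b _ h => Units.ext h)
      (fun y hy => ⟨Units.mk0 y (Finset.ne_of_mem_erase hy), by simp, rfl⟩) (fun _ _ => rfl)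
  have h1' := congrArg (Nat.cast : ℕ → ℚ) h1
  push_cast at h1'
  rw [h2] at h1'
  rw [← Finset.sum_boole, hK, hL]
  simp only [Units.coe_map] at h
  rw [mul_assoc]
  erw [h]
  linear_combination (Fintype.card Lˣ : ℚ) * h1'

end TraceNorm

section Joint

variable {F K₁ K₂ L : Type*} [Field F] [Fintype F] [Field K₁] [Fintype K₁] [Field K₂] [Fintype K₂]
  [Field L] [Algebra F K₁] [Algebra F K₂] [Algebra K₁ L] [Algebra K₂ L]

/-- Every `(q + 1)`-th power is the product of an element of `N₂⁻¹ (F)` and one of `ker N₁`. -/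
theorem exists_pow_decomposition {k₁ k₂ : ℕ} (hk₁ : Module.finrank F K₁ = 2 * k₁)
    (hk₂ : Module.finrank F K₂ = 2 * k₂) (he : Nat.gcd (2 * k₁) (2 * k₂) = 2)
    (hl : Nat.gcd k₂ (Fintype.card F - 1) = 1) (z : Lˣ) :
    ∃ u v : Lˣ, z ^ (Fintype.card F + 1) = u * v ∧ Algebra.norm K₁ (v : L) = 1 ∧
      ∃ e : F, Algebra.norm K₂ (u : L) = algebraMap F K₂ e := by
  have hq1 : 1 < Fintype.card F := Fintype.one_lt_card
  obtain ⟨r, hr⟩ := gcd_card_quotient_dvd hq1 he hl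
  have hK₁ : Fintype.card K₁ = Fintype.card F ^ (2 * k₁) := by
    rw [fintypeCard_eq_pow_finrank F K₁, hk₁]
  have hK₂ : Fintype.card K₂ = Fintype.card F ^ (2 * k₂) := by
    rw [fintypeCard_eq_pow_finrank F K₂, hk₂]
  rw [← hK₁, ← hK₂] at hr
  set a := (Fintype.card K₂ - 1) / (Fintype.card F - 1) with ha
  set b := Fintype.card K₁ - 1 with hb
  have hbez := Nat.gcd_eq_gcd_ab a b
  set i := Nat.gcdA a b
  set j := Nat.gcdB a b
  -- Bézout for `gcd a b`, scaled by `r` to reach `q + 1`. An `a`-th power in `K₂` is a norm down to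
  -- `F`, and a `b`-th power has norm `1` since `b = |K₁ˣ|`.
  refine ⟨(z ^ (i * r)) ^ a, (z ^ (j * r)) ^ b, ?_, ?_, ?_⟩
  · rw [← zpow_natCast, ← zpow_natCast, ← zpow_natCast, ← zpow_mul, ← zpow_mul, ← zpow_add, hr]
    congr 1
    push_cast
    rw [hbez]; ring
  · rw [Units.val_pow_eq_pow_val, map_pow, hb]
    exact FiniteField.pow_card_sub_one_eq_one _ (norm_units_ne_zero _)
  · refine ⟨Algebra.norm F (Algebra.norm K₂ ((z ^ (i * r) : Lˣ) : L)), ?_⟩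
    rw [FiniteField.algebraMap_norm_eq_pow, Units.val_pow_eq_pow_val, map_pow, ha,
      Nat.card_eq_fintype_card, Nat.card_eq_fintype_card]

variable [DecidableEq F] [Fintype L] [DecidableEq L] [Algebra F L] [IsScalarTower F K₁ L]

/-- The number of nonzero `x` with `Tr (N₂ x) = 0` and `Tr (b * N₁ x) = t`. -/
theorem card_units_joint [DecidableEq K₁] {k₁ k₂ : ℕ} (hk₁ : Module.finrank F K₁ = 2 * k₁)
    (hk₂ : Module.finrank F K₂ = 2 * k₂) (he : Nat.gcd (2 * k₁) (2 * k₂) = 2)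
    (hl : Nat.gcd k₂ (Fintype.card F - 1) = 1) {b : K₁} (hb : b ≠ 0) {t : F} (ht : t ≠ 0) :
    (Fintype.card F : ℚ) ^ 2 * ((Fintype.card F : ℚ) ^ (2 * k₁) - 1)
        * ((Fintype.card F : ℚ) ^ (2 * k₂) - 1)
        * (Finset.univ.filter fun x : Lˣ => Algebra.trace F K₂ (Algebra.norm K₂ (x : L)) = 0 ∧
            Algebra.trace F K₁ (b * Algebra.norm K₁ (x : L)) = t).card
      = ((Fintype.card L : ℚ) - 1) *
          ((Fintype.card F : ℚ) ^ (2 * k₁) * ((Fintype.card F : ℚ) ^ (2 * k₂) - Fintype.card F)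
            - ((Fintype.card F : ℚ) - 1) * (-1) ^ (k₁ + k₂) * (Fintype.card F : ℚ) ^ (k₁ + k₂)
              * (((Fintype.card F : ℚ) + 1) * (if b ^ ((Fintype.card K₁ - 1) / (Fintype.card F + 1))
                  = (-1) ^ (k₁ + k₂) then 1 else 0) - 1)) := by
  classical
  set q := Fintype.card F with hqdef
  have hq1 : 1 < q := Fintype.one_lt_card
  have hq1' : (1 : ℚ) < q := by exact_mod_cast hq1
  have hK₁ : Fintype.card K₁ = q ^ (2 * k₁) := by rw [fintypeCard_eq_pow_finrank F K₁, hk₁]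
  have hK₂ : Fintype.card K₂ = q ^ (2 * k₂) := by rw [fintypeCard_eq_pow_finrank F K₂, hk₂]
  have hL : ((Fintype.card L : ℚ) - 1) = Fintype.card Lˣ := by
    rw [Fintype.card_units, Nat.cast_sub Fintype.card_pos, Nat.cast_one]
  have hL0 : ((Fintype.card L : ℚ) - 1) ≠ 0 := by rw [hL]; exact_mod_cast Fintype.card_ne_zero
  have hd₁ : q + 1 ∣ Fintype.card K₁ - 1 := by
    rw [hK₁]; exact add_one_dvd_pow_two_mul_sub_one q k₁ (by omega)
  have hd₂ : q + 1 ∣ Fintype.card K₂ - 1 := by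
    rw [hK₂]; exact add_one_dvd_pow_two_mul_sub_one q k₂ (by omega)
  obtain ⟨kL, hkL⟩ : ∃ kL, Module.finrank F L = 2 * kL :=
    ⟨k₁ * Module.finrank K₁ L, by rw [← Module.finrank_mul_finrank F K₁ L, hk₁, mul_assoc]⟩
  set f₁ : Lˣ → ℚ := fun x =>
    if Algebra.trace F K₁ (b * Algebra.norm K₁ (x : L)) = t then 1 else 0 with hf₁
  -- The factor `1` lets `sum_units_trace_norm` treat `f₁` and `f₂` alike.
  set f₂ : Lˣ → ℚ := fun x =>
    if Algebra.trace F K₂ (1 * Algebra.norm K₂ (x : L)) = 0 then 1 else 0 with hf₂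
  have key := card_sq_mul_sum_mul_of_pow_decomposition (q + 1) f₁ f₂ (fun z => by
    obtain ⟨u, v, h, hv, e, hu⟩ := exists_pow_decomposition (F := F) (L := L) hk₁ hk₂ he hl z
    refine ⟨u, v, h, fun x => ?_, fun x => ?_⟩
    · simp only [hf₁, Units.val_mul, map_mul, hv, mul_one]
    · have hune := norm_units_ne_zero (K := K₂) u
      rw [hu] at hune
      have he0 : e ≠ 0 := by rintro rfl; simp at hune
      simp only [hf₂, Units.val_mul, map_mul, hu, one_mul]
      rw [mul_comm, ← Algebra.smul_def, map_smul, smul_eq_mul]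
      simp [he0])
  have hcount : ((Finset.univ.filter fun x : Lˣ => Algebra.trace F K₂ (Algebra.norm K₂ (x : L)) = 0 ∧
      Algebra.trace F K₁ (b * Algebra.norm K₁ (x : L)) = t).card : ℚ) = ∑ x, f₁ x * f₂ x := by
    rw [← Finset.sum_boole]
    refine Finset.sum_congr rfl fun x _ => ?_
    simp only [hf₁, hf₂, one_mul, ite_and]
    split_ifs <;> simp
  rw [hcount]
  -- `ζ₁` and `ζ₂` label the cosets of `(q + 1)`-th powers in `Lˣ` on which the form over `K₁`,
  -- respectively `K₂`, is degenerate.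
  set ζ₁ : L := (-1) ^ k₁ * (algebraMap K₁ L (b ^ ((Fintype.card K₁ - 1) / (q + 1))))⁻¹ with hζ₁
  set ζ₂ : L := (-1) ^ k₂ with hζ₂
  have hb' : (algebraMap K₁ L (b ^ ((Fintype.card K₁ - 1) / (q + 1)))) ≠ 0 := by
    simpa using fun h => absurd h hb
  set I₁ : Lˣ → ℚ := fun x =>
    if (x : L) ^ ((Fintype.card L - 1) / (q + 1)) = ζ₁ then 1 else 0 with hI₁
  set I₂ : Lˣ → ℚ := fun x =>
    if (x : L) ^ ((Fintype.card L - 1) / (q + 1)) = ζ₂ then 1 else 0 with hI₂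
  have hneg : (-1 : L) ^ (q + 1) = 1 := neg_one_pow_card_add_one F L
  have hneg' : ∀ n : ℕ, ((-1 : L) ^ n) ^ (q + 1) = 1 := fun n => by
    rw [pow_right_comm, hneg, one_pow]
  have hζ₁' : ζ₁ ^ (q + 1) = 1 := by
    rw [hζ₁, mul_pow, hneg', one_mul, inv_pow, ← map_pow, ← pow_mul, Nat.div_mul_cancel hd₁,
      FiniteField.pow_card_sub_one_eq_one b hb, map_one, inv_one]
  have hΦ₁ : ∀ x : Lˣ, ((q : ℚ) ^ (2 * k₁) - 1) * q * ∑ z, f₁ (x * z ^ (q + 1))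
      = ((Fintype.card L : ℚ) - 1) * (q ^ (2 * k₁)
        - (-1) ^ k₁ * q ^ k₁ * (1 - (q + 1) * I₁ x)) := by
    intro x
    have h1 := sum_units_trace_norm (F := F) b t x
    have hbx : b * Algebra.norm K₁ (x : L) ≠ 0 := mul_ne_zero hb (norm_units_ne_zero x)
    have h2 := card_mul_hermitianCount_of_ne_zero (F := F) hk₁ (b * Algebra.norm K₁ (x : L)) ht
    rw [hermitianCount_sub_eq hk₁ hbx] at h2
    have h3 : ((b * Algebra.norm K₁ (x : L)) ^ ((Fintype.card K₁ - 1) / (q + 1)) = (-1) ^ k₁)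
        ↔ (x : L) ^ ((Fintype.card L - 1) / (q + 1)) = ζ₁ := by
      rw [← (algebraMap K₁ L).injective.eq_iff, mul_pow, map_mul,
        algebraMap_norm_pow_quotient hd₁, hζ₁, eq_mul_inv_iff_mul_eq₀ hb', mul_comm]
      simp
    rw [if_congr h3 rfl rfl] at h2
    rw [if_neg ht, sub_zero, hK₁, Nat.cast_pow] at h1
    push_cast at h2
    simp only [hf₁, hI₁]
    linear_combination (q : ℚ) * h1 + ((Fintype.card L : ℚ) - 1) * h2
  have hΦ₂ : ∀ x : Lˣ, ((q : ℚ) ^ (2 * k₂) - 1) * q * ∑ z, f₂ (x * z ^ (q + 1))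
      = ((Fintype.card L : ℚ) - 1) * (q ^ (2 * k₂)
        + (q - 1) * ((-1) ^ k₂ * q ^ k₂ * (1 - (q + 1) * I₂ x)) - q) := by
    intro x
    have h1 := sum_units_trace_norm (F := F) (1 : K₂) 0 x
    have hbx : 1 * Algebra.norm K₂ (x : L) ≠ 0 := by
      rw [one_mul]; exact norm_units_ne_zero x
    have h2 := card_mul_hermitianCount_zero (F := F) hk₂ (1 * Algebra.norm K₂ (x : L))
    rw [hermitianCount_sub_eq hk₂ hbx] at h2
    have h3 : ((1 * Algebra.norm K₂ (x : L)) ^ ((Fintype.card K₂ - 1) / (q + 1)) = (-1) ^ k₂)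
        ↔ (x : L) ^ ((Fintype.card L - 1) / (q + 1)) = ζ₂ := by
      rw [one_mul, ← (algebraMap K₂ L).injective.eq_iff, algebraMap_norm_pow_quotient hd₂, hζ₂]
      simp
    rw [if_congr h3 rfl rfl] at h2
    rw [if_pos rfl, hK₂, Nat.cast_pow] at h1
    push_cast at h2
    simp only [hf₂, hI₂]
    linear_combination (q : ℚ) * h1 + ((Fintype.card L : ℚ) - 1) * h2
  have hS₁ : ((q : ℚ) + 1) * ∑ x, I₁ x = (Fintype.card L : ℚ) - 1 := card_units_pow_eq hkL hζ₁'
  have hS₂ : ((q : ℚ) + 1) * ∑ x, I₂ x = (Fintype.card L : ℚ) - 1 :=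
    card_units_pow_eq hkL (hneg' k₂)
  have hcond : b ^ ((Fintype.card K₁ - 1) / (q + 1)) = (-1) ^ (k₁ + k₂) ↔ ζ₁ = ζ₂ := by
    rw [hζ₁, hζ₂, mul_inv_eq_iff_eq_mul₀ hb', ← (algebraMap K₁ L).injective.eq_iff, pow_add]
    have hsq : ((-1 : L) ^ k₂) * (-1) ^ k₂ = 1 := by rw [← mul_pow]; simp
    push_cast [map_mul, map_pow, map_neg, map_one]
    constructor
    · intro h; rw [h, mul_left_comm, hsq, mul_one]
    · intro h; rw [h, mul_right_comm, hsq, one_mul]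
  -- Two cosets are equal or disjoint. As each `1 - (q + 1) * I` has mean `0`, the product of the
  -- two has mean `(q + 1) * [ζ₁ = ζ₂] - 1`, the only trace of `b` in the result.
  have hS₁₂ : ((q : ℚ) + 1) * ∑ x, I₁ x * I₂ x = ((Fintype.card L : ℚ) - 1)
      * (if b ^ ((Fintype.card K₁ - 1) / (q + 1)) = (-1) ^ (k₁ + k₂) then 1 else 0) := by
    rw [if_congr hcond rfl rfl]
    split_ifs with h
    · rw [mul_one, ← hS₁]
      congr 1
      refine Finset.sum_congr rfl fun x _ => ?_
      simp only [hI₁, hI₂, h]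
      split_ifs <;> simp
    · rw [mul_zero, mul_eq_zero]
      right
      refine Finset.sum_eq_zero fun x _ => ?_
      simp only [hI₁, hI₂]
      split_ifs with h1 h2
      · exact absurd (h1.symm.trans h2) h
      all_goals simp
  rw [← hL] at key
  have hsum : ∑ x : Lˣ, ((q : ℚ) ^ (2 * k₁) - (-1) ^ k₁ * q ^ k₁ * (1 - (q + 1) * I₁ x))
        * (q ^ (2 * k₂) + (q - 1) * ((-1) ^ k₂ * q ^ k₂ * (1 - (q + 1) * I₂ x)) - q)
      = (q ^ (2 * k₁) - (-1) ^ k₁ * q ^ k₁)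
          * (q ^ (2 * k₂) - q + (q - 1) * ((-1) ^ k₂ * q ^ k₂)) * ((Fintype.card L : ℚ) - 1)
        + (-1) ^ k₁ * q ^ k₁ * (q ^ (2 * k₂) - q + (q - 1) * ((-1) ^ k₂ * q ^ k₂))
          * (((q : ℚ) + 1) * ∑ x, I₁ x)
        - (q ^ (2 * k₁) - (-1) ^ k₁ * q ^ k₁) * ((q - 1) * ((-1) ^ k₂ * q ^ k₂))
          * (((q : ℚ) + 1) * ∑ x, I₂ x)
        - (-1) ^ k₁ * q ^ k₁ * ((q - 1) * ((-1) ^ k₂ * q ^ k₂)) * (q + 1)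
          * (((q : ℚ) + 1) * ∑ x, I₁ x * I₂ x) := by
    rw [hL, Fintype.card, Finset.card_eq_sum_ones]
    push_cast
    simp only [Finset.mul_sum, ← Finset.sum_add_distrib, ← Finset.sum_sub_distrib]
    refine Finset.sum_congr rfl fun x _ => ?_
    ring
  rw [hS₁, hS₂, hS₁₂] at hsum
  have hprod : ((q : ℚ) ^ (2 * k₁) - 1) * q * (((q : ℚ) ^ (2 * k₂) - 1) * q)
        * ∑ x, (∑ z, f₁ (x * z ^ (q + 1))) * ∑ w, f₂ (x * w ^ (q + 1))
      = ((Fintype.card L : ℚ) - 1) ^ 2 * ∑ x : Lˣ,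
          ((q : ℚ) ^ (2 * k₁) - (-1) ^ k₁ * q ^ k₁ * (1 - (q + 1) * I₁ x))
        * (q ^ (2 * k₂) + (q - 1) * ((-1) ^ k₂ * q ^ k₂ * (1 - (q + 1) * I₂ x)) - q) := by
    rw [Finset.mul_sum, Finset.mul_sum]
    refine Finset.sum_congr rfl fun x _ => ?_
    rw [mul_mul_mul_comm, hΦ₁, hΦ₂]; ring
  apply mul_left_cancel₀ (pow_ne_zero 2 hL0)
  rw [hsum, ← key] at hprod
  linear_combination hprod

end Joint

/-! ## Minimum distance and the sphere-packing bound -/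

section Packing

variable {F ι : Type*} [Field F] [DecidableEq F] [Fintype ι]

theorem hasMinDist_of_weights {C : Submodule F (ι → F)} {d : ℕ} {u : ι → F} (hu : u ∈ C)
    (hu0 : u ≠ 0) (hud : hammingNorm u ≤ d) (h : ∀ v ∈ C, v ≠ 0 → d ≤ hammingNorm v) :
    HasMinDist C d := by
  refine ⟨⟨u, hu, 0, C.zero_mem, hu0, ?_⟩, ?_⟩
  · rw [hammingDist_zero_right]; exact le_antisymm hud (h u hu hu0)
  · rintro _ ⟨v, hv, w, hw, hne, rfl⟩
    rw [hammingDist_eq_hammingNorm]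
    exact h _ (C.add_mem (C.neg_mem hv) hw) fun h0 => hne (neg_add_eq_zero.1 h0)

theorem HasMinDist.le_hammingDist {C : Submodule F (ι → F)} {d : ℕ} (h : HasMinDist C d)
    {u v : ι → F} (hu : u ∈ C) (hv : v ∈ C) (hne : u ≠ v) : d ≤ hammingDist u v :=
  h.2 ⟨u, hu, v, hv, hne, rfl⟩

theorem hammingNorm_add_le (u v : ι → F) : hammingNorm (u + v) ≤ hammingNorm u + hammingNorm v := by
  have h := hammingDist_triangle (u + v) v 0
  rw [hammingDist_zero_right, hammingDist_zero_right, hammingDist_eq_hammingNorm] at h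
  have e : hammingNorm (-(u + v) + v) = hammingNorm u := by
    simp [hammingNorm]
  rwa [e] at h

theorem hammingNorm_single_le [DecidableEq ι] (i : ι) (a : F) :
    hammingNorm (Pi.single i a : ι → F) ≤ 1 := by
  refine (Finset.card_le_card (t := {i}) fun j hj => ?_).trans (Finset.card_singleton i).le
  rw [Finset.mem_singleton]
  by_contra hne
  simp [hne] at hj

variable [Fintype F]

/-- Words are sorted by support: each support of size `i` carries `(q - 1) ^ i` words. -/
theorem card_hammingNorm_eq [DecidableEq ι] (i : ℕ) :
    (Finset.univ.filter fun u : ι → F => hammingNorm u = i).card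
      = (Fintype.card ι).choose i * (Fintype.card F - 1) ^ i := by
  classical
  have hS : ∀ S : Finset ι, (Finset.univ.filter fun u : ι → F =>
      (Finset.univ.filter fun j => u j ≠ 0) = S).card = (Fintype.card F - 1) ^ S.card := by
    intro S
    have : (Finset.univ.filter fun u : ι → F => (Finset.univ.filter fun j => u j ≠ 0) = S)
        = Fintype.piFinset fun j => if j ∈ S then Finset.univ.erase (0 : F) else {0} := by
      ext u
      simp only [Finset.mem_filter, Finset.mem_univ, true_and, Fintype.mem_piFinset,
        Finset.ext_iff]
      refine forall_congr' fun j => ?_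
      by_cases hj : j ∈ S <;> simp [hj]
    rw [this, Fintype.card_piFinset]
    simp_rw [apply_ite Finset.card]
    rw [Finset.prod_ite]
    simp [Finset.card_univ]
  rw [Finset.card_eq_sum_card_fiberwise (f := fun u : ι → F => Finset.univ.filter fun j => u j ≠ 0)
    (t := Finset.powersetCard i Finset.univ) (fun u hu => by
      have := (Finset.mem_filter.1 (Finset.mem_coe.1 hu)).2
      rw [Finset.mem_coe, Finset.mem_powersetCard]
      exact ⟨Finset.subset_univ _, this⟩)]
  rw [Finset.sum_congr rfl (g := fun _ => (Fintype.card F - 1) ^ i), Finset.sum_const,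
    Finset.card_powersetCard, Finset.card_univ, smul_eq_mul]
  intro S hS'
  have hc := (Finset.mem_powersetCard.1 hS').2
  rw [Finset.filter_filter, ← hc, ← hS S]
  congr 1
  refine Finset.filter_congr fun u _ => and_iff_right_of_imp ?_
  rintro h
  rw [← h]; rfl

theorem card_hammingNorm_le [DecidableEq ι] (r : ℕ) :
    (Finset.univ.filter fun u : ι → F => hammingNorm u ≤ r).card
      = ∑ i ∈ Finset.range (r + 1), (Fintype.card ι).choose i * (Fintype.card F - 1) ^ i := by
  rw [Finset.card_eq_sum_card_fiberwise (f := hammingNorm) (t := Finset.range (r + 1))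
    (fun u hu => by
      have := (Finset.mem_filter.1 (Finset.mem_coe.1 hu)).2
      simpa [Nat.lt_succ_iff] using this)]
  refine Finset.sum_congr rfl fun i hi => ?_
  rw [← card_hammingNorm_eq, Finset.filter_filter]
  congr 1
  refine Finset.filter_congr fun u _ => and_iff_right_of_imp ?_
  rintro rfl
  exact Nat.lt_succ_iff.1 (Finset.mem_range.1 hi)

/-- The sphere-packing (Hamming) bound. -/
theorem spherePackingBound_of_le_hammingDist {C : Submodule F (ι → F)} {d : ℕ} (hd : 0 < d)
    (h : ∀ u ∈ C, ∀ v ∈ C, u ≠ v → d ≤ hammingDist u v) :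
    SpherePackingBound (Fintype.card F) (Fintype.card ι) (Module.finrank F C) d := by
  classical
  unfold SpherePackingBound
  rw [← card_hammingNorm_le, ← Module.card_eq_pow_finrank (K := F) (V := C), ← Fintype.card_fun,
    ← Fintype.card_coe, ← Fintype.card_prod]
  -- Disjointness of the balls around codewords is phrased as injectivity of `(c, e) ↦ c + e`.
  refine Fintype.card_le_of_injective
    (fun p : C × (Finset.univ.filter fun u : ι → F => hammingNorm u ≤ (d - 1) / 2) =>
      (p.1 : ι → F) + p.2) ?_
  rintro ⟨⟨c, hc⟩, ⟨e, he⟩⟩ ⟨⟨c', hc'⟩, ⟨e', he'⟩⟩ heq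
  simp only [Finset.mem_filter, Finset.mem_univ, true_and] at he he' heq
  have hcc : c = c' := by
    by_contra hne
    have h1 := h c hc c' hc' hne
    have h2 : hammingDist c c' ≤ hammingDist c (c + e) + hammingDist (c + e) c' :=
      hammingDist_triangle _ _ _
    have h3 : ∀ a b : ι → F, hammingDist a (a + b) = hammingNorm b := fun a b => by
      simp [hammingDist, hammingNorm]
    rw [h3, heq, hammingDist_comm (c' + e'), h3] at h2
    omega
  subst hcc
  simp only [Prod.mk.injEq, Subtype.mk.injEq, true_and]
  exact add_left_cancel heq

end Packing

/-! ## The numbers in the weight table -/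

/-- The number of `x` in the defining set with `Tr (b * N x) = t ≠ 0`; `A` is `1` or `0` according
to the class of `b`. -/
def traceFiberSize (q : ℚ) (m k₁ k₂ : ℕ) (A : ℚ) : ℚ :=
  (q ^ m - 1) * (q ^ (2 * k₁) * (q ^ (2 * k₂) - q)
      - (q - 1) * (-1) ^ (k₁ + k₂) * q ^ (k₁ + k₂) * ((q + 1) * A - 1))
    / (q ^ 2 * (q ^ (2 * k₁) - 1) * (q ^ (2 * k₂) - 1))

/-- The length of the code. -/
def codeLength (q : ℚ) (m m₂ : ℕ) : ℚ :=
  (q ^ m - 1) * (q ^ m₂ - q) / (q * (q ^ m₂ - 1)) + 1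

/-- Rewrites the table in terms of the length and the two fibre sizes, the form in which weights
arise by counting zeros. -/
theorem tableWeight_eq {q : ℚ} (hq : 1 < q) (m : ℕ) {k₁ k₂ : ℕ} (h₁ : k₁ ≠ 0) (h₂ : k₂ ≠ 0) :
    tableWeight q m (2 * k₁) (2 * k₂) = ![0, codeLength q m (2 * k₂),
      (q - 1) * traceFiberSize q m k₁ k₂ 1, (q - 1) * traceFiberSize q m k₁ k₂ 0,
      codeLength q m (2 * k₂) - traceFiberSize q m k₁ k₂ 1,
      codeLength q m (2 * k₂) - traceFiberSize q m k₁ k₂ 0] := by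
  obtain ⟨a, rfl⟩ := Nat.exists_eq_succ_of_ne_zero h₁
  obtain ⟨b, rfl⟩ := Nat.exists_eq_succ_of_ne_zero h₂
  have hq0 : q ≠ 0 := by positivity
  have ha : q ^ (2 * (a + 1)) - 1 ≠ 0 := (sub_pos.2 (one_lt_pow₀ hq (by omega))).ne'
  have hb : q ^ (2 * (b + 1)) - 1 ≠ 0 := (sub_pos.2 (one_lt_pow₀ hq (by omega))).ne'
  have e1 : 2 * (a + 1) - 1 = 2 * a + 1 := by omega
  have e2 : 2 * (b + 1) - 1 = 2 * b + 1 := by omega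
  have e3 : (2 * (a + 1) + 2 * (b + 1)) / 2 = a + b + 2 := by omega
  have e4 : a + b + 2 - 1 = a + b + 1 := by omega
  have e5 : a + b + 2 - 2 = a + b := by omega
  unfold tableWeight traceFiberSize codeLength
  simp only [Nat.succ_eq_add_one, e1, e2, e3, e4, e5]
  funext i
  fin_cases i
  · rfl
  · rfl
  all_goals
    simp
    field_simp
    ring

theorem abs_sign_mul_le {q : ℚ} (hq : 1 < q) (k : ℕ) {A : ℚ} (hA : A = 0 ∨ A = 1) :
    (-1) ^ k * ((q + 1) * A - 1) ≤ q := by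
  rcases neg_one_pow_eq_or ℚ k with h | h <;> rcases hA with rfl | rfl <;> rw [h] <;> linarith

/-- The main term is at least `(q - 1) * q ^ (2 * (k₁ + k₂) - 1)` and the correction at most `(q -
1) * q ^ (k₁ + k₂ + 1)`; the first exponent is larger as soon as `k₁ + k₂ ≥ 3`. -/
theorem traceFiberSize_pos {q : ℚ} (hq : 1 < q) {m k₁ k₂ : ℕ} (hm : m ≠ 0) (h₁ : k₁ ≠ 0)
    (h₂ : k₂ ≠ 0) (h : 3 ≤ k₁ + k₂) {A : ℚ} (hA : A = 0 ∨ A = 1) :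
    0 < traceFiberSize q m k₁ k₂ A := by
  obtain ⟨a, rfl⟩ := Nat.exists_eq_succ_of_ne_zero h₁
  obtain ⟨b, rfl⟩ := Nat.exists_eq_succ_of_ne_zero h₂
  have hq0 : 0 < q := by positivity
  have hm' : 0 < q ^ m - 1 := sub_pos.2 (one_lt_pow₀ hq hm)
  have ha : 0 < q ^ (2 * (a + 1)) - 1 := sub_pos.2 (one_lt_pow₀ hq (by omega))
  have hb : 0 < q ^ (2 * (b + 1)) - 1 := sub_pos.2 (one_lt_pow₀ hq (by omega))
  refine div_pos (mul_pos hm' (sub_pos.2 ?_)) (by positivity)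
  simp only [Nat.succ_eq_add_one]
  have h1 := abs_sign_mul_le hq (a + 1 + (b + 1)) hA
  have h2 : (q - 1) * (-1) ^ (a + 1 + (b + 1)) * q ^ (a + 1 + (b + 1)) * ((q + 1) * A - 1)
      ≤ (q - 1) * q ^ (a + b + 3) := by
    calc _ = (q - 1) * q ^ (a + b + 2) * ((-1) ^ (a + 1 + (b + 1)) * ((q + 1) * A - 1)) := by ring
      _ ≤ (q - 1) * q ^ (a + b + 2) * q :=
        mul_le_mul_of_nonneg_left h1 (mul_nonneg (by linarith) (by positivity))
      _ = _ := by ring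
  have h3 : (q - 1) * q ^ (2 * (a + b) + 3)
      ≤ q ^ (2 * (a + 1)) * (q ^ (2 * (b + 1)) - q) := by
    have h4 : 1 ≤ q ^ (2 * b) := one_le_pow₀ hq.le
    have h5 : (q - 1) * q ^ (2 * b + 1) ≤ q ^ (2 * (b + 1)) - q := by
      have : q ^ (2 * (b + 1)) = q * (q * q ^ (2 * b)) := by ring
      rw [this, pow_succ]
      nlinarith
    calc _ = q ^ (2 * (a + 1)) * ((q - 1) * q ^ (2 * b + 1)) := by ring
      _ ≤ _ := mul_le_mul_of_nonneg_left h5 (by positivity)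
  have h6 : (q - 1) * q ^ (a + b + 3) < (q - 1) * q ^ (2 * (a + b) + 3) :=
    mul_lt_mul_of_pos_left (pow_lt_pow_right₀ hq (by omega)) (by linarith)
  linarith

theorem traceFiberSize_one_ne_traceFiberSize_zero {q : ℚ} (hq : 1 < q) {m k₁ k₂ : ℕ} (hm : m ≠ 0) (h₁ : k₁ ≠ 0)
    (h₂ : k₂ ≠ 0) : traceFiberSize q m k₁ k₂ 1 ≠ traceFiberSize q m k₁ k₂ 0 := by
  have hq0 : q ≠ 0 := by positivity
  have hm' : q ^ m - 1 ≠ 0 := (sub_pos.2 (one_lt_pow₀ hq hm)).ne'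
  have ha : q ^ (2 * k₁) - 1 ≠ 0 := (sub_pos.2 (one_lt_pow₀ hq (by omega))).ne'
  have hb : q ^ (2 * k₂) - 1 ≠ 0 := (sub_pos.2 (one_lt_pow₀ hq (by omega))).ne'
  intro h
  unfold traceFiberSize at h
  rw [div_left_inj' (mul_ne_zero (mul_ne_zero (pow_ne_zero 2 hq0) ha) hb)] at h
  have h1 := mul_left_cancel₀ hm' h
  have h2 : (q - 1) * (-1) ^ (k₁ + k₂) * q ^ (k₁ + k₂) * (q + 1) = 0 := by linear_combination -h1
  have h3 : (q - 1) ≠ 0 := by linarith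
  have h4 : (q + 1) ≠ 0 := by positivity
  exact mul_ne_zero (mul_ne_zero (mul_ne_zero h3 (pow_ne_zero _ (by norm_num)))
    (pow_ne_zero _ hq0)) h4 h2

/-- The arithmetic behind the five weights being distinct. -/
theorem weight_equation_impossible {q : ℕ} (hq : 1 < q) {m a b : ℕ} (hm0 : m ≠ 0)
    (hg : Nat.gcd (2 * (a + 1)) (2 * (b + 1)) = 2) (hd₁ : 2 * (a + 1) ∣ m)
    (hd₂ : 2 * (b + 1) ∣ m) (hm4 : m ≠ 4) (hab : 1 ≤ a + b) {T : ℤ}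
    (hT : T = (q : ℤ) ^ 2 ∨ T = -q ∨ T = (q : ℤ) ^ 2 - q - 1 ∨ T = 1) :
    ((q : ℤ) ^ m - 1)
        * ((q : ℤ) ^ (2 * b + 1) - 1 - ((q : ℤ) - 1) * (-1) ^ (a + b) * (q : ℤ) ^ (a + b) * T)
      ≠ ((q : ℤ) ^ (2 * (a + 1)) - 1) * ((q : ℤ) ^ (2 * (b + 1)) - 1) := by
  intro h
  have hqz : (1 : ℤ) < q := by exact_mod_cast hq
  have pos : ∀ n, n ≠ 0 → 0 < (q : ℤ) ^ n - 1 := fun n hn => sub_pos.2 (one_lt_pow₀ hqz hn)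
  set X := (q : ℤ) ^ (2 * b + 1) - 1 - ((q : ℤ) - 1) * (-1) ^ (a + b) * (q : ℤ) ^ (a + b) * T
    with hX
  have hXpos : 0 < X := by
    have : 0 < ((q : ℤ) ^ m - 1) * X := by
      rw [h]; exact mul_pos (pos _ (by omega)) (pos _ (by omega))
    exact pos_of_mul_pos_right this (pos m hm0).le
  -- `X` is a positive integer, so `q ^ m - 1` cannot exceed the right-hand side.
  have hlt : m < 2 * (a + 1) + 2 * (b + 1) := by
    by_contra hge
    have h1 : (q : ℤ) ^ (2 * (a + 1) + 2 * (b + 1)) ≤ (q : ℤ) ^ m :=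
      pow_le_pow_right₀ hqz.le (by omega)
    have h2 : ((q : ℤ) ^ m - 1) * 1 ≤ ((q : ℤ) ^ m - 1) * X :=
      mul_le_mul_of_nonneg_left hXpos (pos m hm0).le
    rw [h] at h2
    rw [pow_add] at h1
    have h3 := pos (2 * (a + 1)) (by omega)
    have h4 := pos (2 * (b + 1)) (by omega)
    nlinarith
  have hcop : Nat.Coprime (a + 1) (b + 1) := by
    rw [Nat.gcd_mul_left] at hg; exact Nat.eq_of_mul_eq_mul_left (by norm_num) (hg.trans (by norm_num))
  obtain ⟨m', rfl⟩ : ∃ m', m = 2 * m' := ⟨m / 2, by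
    have := (dvd_mul_right 2 (a + 1)).trans hd₁; omega⟩
  have hd₁' : a + 1 ∣ m' := Nat.dvd_of_mul_dvd_mul_left (by norm_num) hd₁
  have hd₂' : b + 1 ∣ m' := Nat.dvd_of_mul_dvd_mul_left (by norm_num) hd₂
  obtain ⟨j, rfl⟩ := hcop.mul_dvd_of_dvd_of_dvd hd₁' hd₂'
  have hj : 1 ≤ j := by
    rcases Nat.eq_zero_or_pos j with rfl | hj
    · simp at hm0
    · exact hj
  -- By coprimality `m = 2 * (a + 1) * (b + 1) * j`, and a product of two integers that are at least
  -- `2` is no smaller than their sum, against `hlt`.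
  have hcases : a = 0 ∨ b = 0 := by
    by_contra hne
    push Not at hne
    obtain ⟨a', rfl⟩ := Nat.exists_eq_succ_of_ne_zero hne.1
    obtain ⟨b', rfl⟩ := Nat.exists_eq_succ_of_ne_zero hne.2
    have hab0 : 1 ≤ a' + b' := by
      by_contra h0
      have : a' = 0 ∧ b' = 0 := by omega
      obtain ⟨rfl, rfl⟩ := this
      simp at hcop
    simp only [Nat.succ_eq_add_one] at hlt
    nlinarith [Nat.zero_le (a' * b'), Nat.zero_le ((a' + 2) * (b' + 2) * (j - 1)),
      Nat.mul_le_mul_left ((a' + 1 + 1) * (b' + 1 + 1)) hj]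
  have hq0 : (q : ℤ) ≠ 0 := by positivity
  have hndvd : ∀ x : ℤ, ¬ (q : ℤ) * x = 1 := fun x hx => by
    have := Int.le_of_dvd one_pos ⟨x, hx.symm⟩
    omega
  have hsign := neg_one_pow_eq_or ℤ (a + b)
  rcases hcases with rfl | rfl
  · have hj1 : j = 1 := by nlinarith
    subst hj1
    have e : 2 * ((0 + 1) * (b + 1) * 1) = 2 * (b + 1) := by ring
    rw [e, mul_comm] at h
    have hXe := mul_right_cancel₀ (pos (2 * (b + 1)) (by omega)).ne' h
    rw [zero_add] at hX hsign hXe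
    rw [e] at hm4
    -- Here `m = 2 * (b + 1)`, so `b = 1` is the excluded case `m = 4`. The equation now reads `X =
    -- q ^ 2 - 1` and can be divided by `q ^ 2`.
    obtain ⟨b, rfl⟩ : ∃ b', b = b' + 2 := ⟨b - 2, by omega⟩
    have h1 : (q : ℤ) ^ (2 * b + 3) - 1 = ((q : ℤ) - 1) * ((-1) ^ (b + 2) * (q : ℤ) ^ b * T) := by
      apply mul_left_cancel₀ (pow_ne_zero 2 hq0)
      rw [hX] at hXe
      linear_combination hXe
    -- For positive `b` reduction modulo `q` is contradictory; for `b = 0` the value of `T` is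
    -- forced and is not in the list.
    rcases Nat.eq_zero_or_pos b with rfl | hb
    · have h2 : T = (q : ℤ) ^ 2 + q + 1 := by
        apply mul_left_cancel₀ (sub_ne_zero.2 hqz.ne')
        linear_combination -h1
      rcases hT with rfl | rfl | rfl | rfl <;> nlinarith
    · obtain ⟨b, rfl⟩ := Nat.exists_eq_succ_of_ne_zero hb.ne'
      apply hndvd ((q : ℤ) ^ (2 * b + 4) - ((q : ℤ) - 1) * ((-1) ^ (b + 3) * (q : ℤ) ^ b * T))
      simp only [Nat.succ_eq_add_one] at h1
      linear_combination h1
  · have hj1 : j = 1 := by nlinarith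
    subst hj1
    have e : 2 * ((a + 1) * (0 + 1) * 1) = 2 * (a + 1) := by ring
    rw [e] at h
    have hXe := mul_left_cancel₀ (pos (2 * (a + 1)) (by omega)).ne' h
    rw [e] at hm4
    obtain ⟨a, rfl⟩ : ∃ a', a = a' + 2 := ⟨a - 2, by omega⟩
    have h1 : (-1) ^ a * (q : ℤ) ^ (a + 1) * T = -1 := by
      apply mul_left_cancel₀ (mul_ne_zero (sub_ne_zero.2 hqz.ne') hq0)
      rw [hX] at hXe
      linear_combination -hXe
    apply hndvd (-((-1) ^ a * (q : ℤ) ^ a * T))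
    linear_combination -h1

/-- Equality would be a coincidence between a weight `(q - 1) V_A` of a word with `c = 0` and a
weight `n - V_B` of one with `c ≠ 0`. -/
theorem mul_traceFiberSize_add_ne {q : ℕ} (hq : 1 < q) {m k₁ k₂ : ℕ} (hm0 : m ≠ 0) (h₁ : k₁ ≠ 0)
    (h₂ : k₂ ≠ 0) (hg : Nat.gcd (2 * k₁) (2 * k₂) = 2) (hd₁ : 2 * k₁ ∣ m) (hd₂ : 2 * k₂ ∣ m)
    (hm4 : m ≠ 4) (h3 : 3 ≤ k₁ + k₂) {A B : ℚ} (hA : A = 0 ∨ A = 1) (hB : B = 0 ∨ B = 1) :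
    ((q : ℚ) - 1) * traceFiberSize q m k₁ k₂ A + traceFiberSize q m k₁ k₂ B
      ≠ codeLength q m (2 * k₂) := by
  obtain ⟨a, rfl⟩ := Nat.exists_eq_succ_of_ne_zero h₁
  obtain ⟨b, rfl⟩ := Nat.exists_eq_succ_of_ne_zero h₂
  simp only [Nat.succ_eq_add_one] at *
  intro h
  have hqq : (1 : ℚ) < q := by exact_mod_cast hq
  have hq0 : (q : ℚ) ≠ 0 := by positivity
  have ha : (q : ℚ) ^ (2 * (a + 1)) - 1 ≠ 0 := (sub_pos.2 (one_lt_pow₀ hqq (by omega))).ne'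
  have hb : (q : ℚ) ^ (2 * (b + 1)) - 1 ≠ 0 := (sub_pos.2 (one_lt_pow₀ hqq (by omega))).ne'
  have main : ((q : ℚ) ^ m - 1) * ((q : ℚ) ^ (2 * b + 1) - 1 - ((q : ℚ) - 1) * (-1) ^ (a + b)
        * (q : ℚ) ^ (a + b) * (((q : ℚ) - 1) * (((q : ℚ) + 1) * A - 1) + (((q : ℚ) + 1) * B - 1)))
      = ((q : ℚ) ^ (2 * (a + 1)) - 1) * ((q : ℚ) ^ (2 * (b + 1)) - 1) := by
    unfold traceFiberSize codeLength at h
    field_simp at h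
    apply mul_left_cancel₀ (pow_ne_zero 2 hq0)
    linear_combination h
  -- The four choices of `(A, B)` give the four integers `T` allowed in
  -- `weight_equation_impossible`.
  obtain ⟨T, hT, hTe⟩ : ∃ T : ℤ,
      (T = (q : ℤ) ^ 2 ∨ T = -q ∨ T = (q : ℤ) ^ 2 - q - 1 ∨ T = 1) ∧
      (T : ℚ) = ((q : ℚ) - 1) * (((q : ℚ) + 1) * A - 1) + (((q : ℚ) + 1) * B - 1) := by
    rcases hA with rfl | rfl <;> rcases hB with rfl | rfl
    · exact ⟨-q, by simp, by push_cast; ring⟩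
    · exact ⟨1, by simp, by push_cast; ring⟩
    · exact ⟨(q : ℤ) ^ 2 - q - 1, by simp, by push_cast; ring⟩
    · exact ⟨(q : ℤ) ^ 2, by simp, by push_cast; ring⟩
  rw [← hTe] at main
  refine weight_equation_impossible hq hm0 hg hd₁ hd₂ hm4 (by omega) hT ?_
  exact_mod_cast main

/-! ## The weights of the code -/

section Weights

variable {F K₁ K₂ L : Type*} [Field F] [DecidableEq F] [Field K₁] [Field K₂] [Field L] [Fintype L]
  [Algebra F K₁] [Algebra F K₂] [Algebra K₁ L] [Algebra K₂ L]

theorem mem_definingSet {x : L} :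
    x ∈ definingSet F K₂ L ↔ Algebra.trace F K₂ (Algebra.norm K₂ x) = 0 := by
  simp [definingSet]

theorem zero_mem_definingSet : (0 : L) ∈ definingSet F K₂ L := by
  rw [mem_definingSet, Algebra.norm_zero, map_zero]

theorem augmentedEncoder_apply (p : K₁ × F) (x : definingSet F K₂ L) :
    augmentedEncoder F K₁ K₂ L p x
      = Algebra.trace F K₁ (p.1 * Algebra.norm K₁ (x : L)) + p.2 := rfl

variable (K₂ L) in
/-- The number of `x ∈ D` with `Tr (b * N x) = t`. -/
noncomputable def traceCount (b : K₁) (t : F) : ℕ :=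
  (Finset.univ.filter fun x : definingSet F K₂ L =>
    Algebra.trace F K₁ (b * Algebra.norm K₁ (x : L)) = t).card

theorem sum_traceCount [Fintype F] (b : K₁) :
    ∑ t : F, traceCount K₂ L b t = Fintype.card (definingSet F K₂ L) :=
  (Finset.card_eq_sum_card_fiberwise (fun _ _ => Finset.mem_coe.2 (Finset.mem_univ _))).symm

theorem hammingNorm_encoder_add (b : K₁) (c : F) :
    hammingNorm (augmentedEncoder F K₁ K₂ L (b, c)) + traceCount K₂ L b (-c)
      = Fintype.card (definingSet F K₂ L) := by
  have h := Finset.card_filter_add_card_filter_not (s := (Finset.univ : Finset (definingSet F K₂ L)))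
    (fun x => augmentedEncoder F K₁ K₂ L (b, c) x ≠ 0)
  rw [hammingNorm, traceCount, ← Finset.card_univ, ← h]
  congr 2
  refine Finset.filter_congr fun x _ => ?_
  rw [not_not, augmentedEncoder_apply, add_eq_zero_iff_eq_neg]

/-- The point `x = 0` always counts. This makes `(q - 1) V_A < n` strict in `tableWeight_injective`.
-/
theorem traceCount_zero_pos (b : K₁) : 0 < traceCount K₂ L b (0 : F) := by
  refine Finset.card_pos.2 ⟨⟨0, zero_mem_definingSet⟩, ?_⟩
  simp [Algebra.norm_zero]

theorem card_definingSet_eq_units [DecidableEq L] :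
    Fintype.card (definingSet F K₂ L)
      = (Finset.univ.filter fun x : Lˣ =>
          Algebra.trace F K₂ (Algebra.norm K₂ (x : L)) = 0).card + 1 := by
  rw [Fintype.card_coe, ← Finset.card_erase_add_one zero_mem_definingSet]
  congr 1
  symm
  refine Finset.card_bij (fun x _ => (x : L)) (fun x hx => ?_) (fun a _ b _ h => Units.ext h)
    (fun y hy => ?_)
  · simpa [mem_definingSet] using hx
  · rw [Finset.mem_erase, mem_definingSet] at hy
    exact ⟨Units.mk0 y hy.1, by simpa using hy.2, rfl⟩

variable [Fintype F] [Fintype K₁] [DecidableEq K₁] [Fintype K₂] [Algebra F L]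
  [IsScalarTower F K₁ L]

theorem card_definingSet {m₂ : ℕ} (hm₂ : Module.finrank F K₂ = m₂) :
    (Fintype.card (definingSet F K₂ L) : ℚ)
      = codeLength (Fintype.card F) (Module.finrank F L) m₂ := by
  classical
  have h := card_units_trace_norm_eq_zero (F := F) (K := K₂) (L := L)
  have hq : (1 : ℚ) < Fintype.card F := by exact_mod_cast Fintype.one_lt_card (α := F)
  have hm0 : m₂ ≠ 0 := by rw [← hm₂]; exact (Module.finrank_pos).ne'
  rw [fintypeCard_eq_pow_finrank F K₂, fintypeCard_eq_pow_finrank F L, hm₂] at h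
  push_cast at h
  have hb : (Fintype.card F : ℚ) ^ m₂ - 1 ≠ 0 := (sub_pos.2 (one_lt_pow₀ hq hm0)).ne'
  have hq0 : (Fintype.card F : ℚ) ≠ 0 := by positivity
  rw [card_definingSet_eq_units, codeLength, Nat.cast_add, Nat.cast_one, ← h,
    mul_div_cancel_left₀ _ (mul_ne_zero hq0 hb)]

/-- The class of `b` that decides the weight of its codeword. -/
def classIndicator (F : Type*) [Fintype F] {K : Type*} [Field K] [Fintype K] [DecidableEq K]
    (h : ℕ) (b : K) : ℚ :=
  if b ^ ((Fintype.card K - 1) / (Fintype.card F + 1)) = (-1) ^ h then 1 else 0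

theorem classIndicator_eq_or (F : Type*) [Fintype F] {K : Type*} [Field K] [Fintype K]
    [DecidableEq K] (h : ℕ) (b : K) : classIndicator F h b = 0 ∨ classIndicator F h b = 1 := by
  unfold classIndicator; split_ifs <;> simp

theorem traceCount_eq {k₁ k₂ : ℕ} (hk₁ : Module.finrank F K₁ = 2 * k₁)
    (hk₂ : Module.finrank F K₂ = 2 * k₂) (he : Nat.gcd (2 * k₁) (2 * k₂) = 2)
    (hl : Nat.gcd k₂ (Fintype.card F - 1) = 1) {b : K₁} (hb : b ≠ 0) {t : F} (ht : t ≠ 0) :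
    (traceCount K₂ L b t : ℚ) = traceFiberSize (Fintype.card F) (Module.finrank F L) k₁ k₂
      (classIndicator F (k₁ + k₂) b) := by
  classical
  have h := card_units_joint (L := L) hk₁ hk₂ he hl hb ht
  have hq : (1 : ℚ) < Fintype.card F := by exact_mod_cast Fintype.one_lt_card (α := F)
  have hk₁0 : 2 * k₁ ≠ 0 := by rw [← hk₁]; exact (Module.finrank_pos).ne'
  have hk₂0 : 2 * k₂ ≠ 0 := by rw [← hk₂]; exact (Module.finrank_pos).ne'
  have ha : (Fintype.card F : ℚ) ^ (2 * k₁) - 1 ≠ 0 := (sub_pos.2 (one_lt_pow₀ hq hk₁0)).ne'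
  have hb' : (Fintype.card F : ℚ) ^ (2 * k₂) - 1 ≠ 0 := (sub_pos.2 (one_lt_pow₀ hq hk₂0)).ne'
  have hq0 : (Fintype.card F : ℚ) ≠ 0 := by positivity
  have hcount : traceCount K₂ L b t = (Finset.univ.filter fun x : Lˣ =>
      Algebra.trace F K₂ (Algebra.norm K₂ (x : L)) = 0 ∧
        Algebra.trace F K₁ (b * Algebra.norm K₁ (x : L)) = t).card := by
    symm
    refine Finset.card_bij (fun x hx => ⟨(x : L), mem_definingSet.2 (Finset.mem_filter.1 hx).2.1⟩)
      (fun x hx => ?_) (fun a _ b _ h => Units.ext (congrArg Subtype.val h)) (fun y hy => ?_)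
    · simpa using (Finset.mem_filter.1 hx).2.2
    · have hy' := (Finset.mem_filter.1 hy).2
      -- Since `t ≠ 0`, the point `0` of `D` is not counted, and the count over units suffices.
      have hy0 : (y : L) ≠ 0 := by
        intro h0
        rw [h0, Algebra.norm_zero, mul_zero, map_zero] at hy'
        exact ht hy'.symm
      exact ⟨Units.mk0 _ hy0, by simpa using ⟨mem_definingSet.1 y.2, hy'⟩, rfl⟩
  rw [fintypeCard_eq_pow_finrank F L, Nat.cast_pow] at h
  rw [traceFiberSize, classIndicator, ← h, ← hcount,
    mul_div_cancel_left₀ _ (mul_ne_zero (mul_ne_zero (pow_ne_zero 2 hq0) ha) hb')]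

theorem traceCount_zero_add {k₁ k₂ : ℕ} (hk₁ : Module.finrank F K₁ = 2 * k₁)
    (hk₂ : Module.finrank F K₂ = 2 * k₂) (he : Nat.gcd (2 * k₁) (2 * k₂) = 2)
    (hl : Nat.gcd k₂ (Fintype.card F - 1) = 1) {b : K₁} (hb : b ≠ 0) :
    (traceCount K₂ L b (0 : F) : ℚ) + ((Fintype.card F : ℚ) - 1) * traceFiberSize (Fintype.card F)
        (Module.finrank F L) k₁ k₂ (classIndicator F (k₁ + k₂) b)
      = Fintype.card (definingSet F K₂ L) := by
  rw [← sum_traceCount (F := F) (K₂ := K₂) (L := L) b, Nat.cast_sum,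
    ← Finset.add_sum_erase _ _ (Finset.mem_univ (0 : F)),
    Finset.sum_congr rfl (fun t ht => traceCount_eq (L := L) hk₁ hk₂ he hl hb
      (Finset.ne_of_mem_erase ht)), Finset.sum_const,
    Finset.card_erase_of_mem (Finset.mem_univ _), Finset.card_univ, nsmul_eq_mul,
    Nat.cast_sub Fintype.card_pos, Nat.cast_one]

/-- The row of the weight table to which the codeword of `(b, c)` belongs. -/
def tableRow (F : Type*) [Field F] [Fintype F] [DecidableEq F] {K : Type*} [Field K] [Fintype K]
    [DecidableEq K] (h : ℕ) (p : K × F) : Fin 6 :=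
  if p.1 = 0 then if p.2 = 0 then 0 else 1
  else if p.1 ^ ((Fintype.card K - 1) / (Fintype.card F + 1)) = (-1) ^ h then
    if p.2 = 0 then 2 else 4
  else if p.2 = 0 then 3 else 5

theorem hammingNorm_encoder {k₁ k₂ : ℕ} (hk₁ : Module.finrank F K₁ = 2 * k₁)
    (hk₂ : Module.finrank F K₂ = 2 * k₂) (he : Nat.gcd (2 * k₁) (2 * k₂) = 2)
    (hl : Nat.gcd k₂ (Fintype.card F - 1) = 1) (p : K₁ × F) :
    (hammingNorm (augmentedEncoder F K₁ K₂ L p) : ℚ)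
      = tableWeight (Fintype.card F) (Module.finrank F L) (2 * k₁) (2 * k₂)
          (tableRow F (k₁ + k₂) p) := by
  have hq : (1 : ℚ) < Fintype.card F := by exact_mod_cast Fintype.one_lt_card (α := F)
  have hk₁0 : 2 * k₁ ≠ 0 := by rw [← hk₁]; exact (Module.finrank_pos).ne'
  have hk₂0 : 2 * k₂ ≠ 0 := by rw [← hk₂]; exact (Module.finrank_pos).ne'
  rw [tableWeight_eq hq _ (by omega) (by omega), ← card_definingSet (F := F) (K₂ := K₂) (L := L) hk₂]
  obtain ⟨b, c⟩ := p
  have hn := hammingNorm_encoder_add (K₂ := K₂) (L := L) b c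
  have hn' := congrArg (Nat.cast : ℕ → ℚ) hn
  push_cast at hn'
  by_cases hb : b = 0
  · subst hb
    by_cases hc : c = 0
    · subst hc
      have h0 : augmentedEncoder F K₁ K₂ L (0, 0) = 0 := map_zero _
      rw [h0]
      simp [tableRow]
    · have h0 : traceCount K₂ L (0 : K₁) (-c) = 0 := by
        simp [traceCount, hc, eq_comm]
      rw [h0] at hn'
      simp [tableRow, hc]
      simpa using hn'
  · have hT := fun (t : F) (ht : t ≠ 0) => traceCount_eq (L := L) hk₁ hk₂ he hl hb ht
    by_cases hc : c = 0
    · subst hc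
      have hs := traceCount_zero_add (L := L) hk₁ hk₂ he hl hb
      rw [neg_zero] at hn'
      have hval : (hammingNorm (augmentedEncoder F K₁ K₂ L (b, 0)) : ℚ)
          = ((Fintype.card F : ℚ) - 1) * traceFiberSize (Fintype.card F) (Module.finrank F L) k₁ k₂
            (classIndicator F (k₁ + k₂) b) := by linarith
      rw [hval]
      simp only [tableRow, classIndicator, hb, if_true, if_false]
      split_ifs <;> simp
    · rw [hT (-c) (neg_ne_zero.2 hc)] at hn'
      rw [eq_sub_of_add_eq hn']
      simp only [tableRow, classIndicator, hb, hc, if_false]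
      split_ifs <;> simp

/-- The coordinate at `x = 0` reads off `c`. If then `b ≠ 0`, positivity of the fibre sizes gives a
coordinate equal to `1`. -/
theorem augmentedEncoder_injective {k₁ k₂ : ℕ} (hk₁ : Module.finrank F K₁ = 2 * k₁)
    (hk₂ : Module.finrank F K₂ = 2 * k₂) (he : Nat.gcd (2 * k₁) (2 * k₂) = 2)
    (hl : Nat.gcd k₂ (Fintype.card F - 1) = 1) (h3 : 3 ≤ k₁ + k₂) :
    Function.Injective (augmentedEncoder F K₁ K₂ L) := by
  have hq : (1 : ℚ) < Fintype.card F := by exact_mod_cast Fintype.one_lt_card (α := F)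
  have hk₁0 : 2 * k₁ ≠ 0 := by rw [← hk₁]; exact (Module.finrank_pos).ne'
  have hk₂0 : 2 * k₂ ≠ 0 := by rw [← hk₂]; exact (Module.finrank_pos).ne'
  rw [← LinearMap.ker_eq_bot, LinearMap.ker_eq_bot']
  rintro ⟨b, c⟩ h
  have h0 := congrFun h ⟨0, zero_mem_definingSet⟩
  rw [augmentedEncoder_apply] at h0
  simp only [Algebra.norm_zero, mul_zero, map_zero, zero_add, Pi.zero_apply] at h0
  subst h0
  by_contra hne
  have hb : b ≠ 0 := fun hb => hne (by rw [hb]; rfl)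
  have hT := traceCount_eq (L := L) hk₁ hk₂ he hl hb (one_ne_zero (α := F))
  have hpos := traceFiberSize_pos hq (m := Module.finrank F L)
    (Module.finrank_pos).ne' (by omega) (by omega) h3 (classIndicator_eq_or F (k₁ + k₂) b)
  rw [← hT] at hpos
  have hpos' : 0 < traceCount K₂ L b (1 : F) := by exact_mod_cast hpos
  obtain ⟨x, hx⟩ := Finset.card_pos.1 hpos'
  have hx1 := (Finset.mem_filter.1 hx).2
  have hx2 := congrFun h x
  rw [augmentedEncoder_apply, hx1] at hx2
  simp at hx2

omit [DecidableEq F] in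
theorem card_classIndicator {k₁ : ℕ} (hk₁ : Module.finrank F K₁ = 2 * k₁) (h : ℕ) :
    ((Fintype.card F : ℚ) + 1) * ∑ b ∈ Finset.univ.erase (0 : K₁), classIndicator F h b
      = (Fintype.card F : ℚ) ^ (2 * k₁) - 1 := by
  have hneg : ((-1 : K₁) ^ h) ^ (Fintype.card F + 1) = 1 := by
    rw [pow_right_comm, neg_one_pow_card_add_one F K₁, one_pow]
  rw [← Nat.cast_pow, ← hk₁, ← fintypeCard_eq_pow_finrank F K₁, ← card_units_pow_eq hk₁ hneg]
  congr 1
  symm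
  exact Finset.sum_bij (fun y _ => (y : K₁)) (fun y _ => by simp)
    (fun a _ b _ h => Units.ext h)
    (fun y hy => ⟨Units.mk0 y (Finset.ne_of_mem_erase hy), by simp, rfl⟩) (fun _ _ => rfl)

/-- An arbitrary test function `g` handles all rows at once. With `g` the indicator of a weight,
frequencies of rows of equal weight add up by themselves. -/
theorem sum_tableRow {k₁ : ℕ} (hk₁ : Module.finrank F K₁ = 2 * k₁) (h : ℕ) (g : Fin 6 → ℚ) :
    ∑ p : K₁ × F, g (tableRow F h p)
      = ∑ i, tableFreq (Fintype.card F) (2 * k₁) i * g i := by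
  have hq : (1 : ℚ) < Fintype.card F := by exact_mod_cast Fintype.one_lt_card (α := F)
  have hq1 : (Fintype.card F : ℚ) + 1 ≠ 0 := by positivity
  have hA := card_classIndicator hk₁ h
  have hcard : ((Finset.univ.erase (0 : K₁)).card : ℚ) = (Fintype.card F : ℚ) ^ (2 * k₁) - 1 := by
    rw [Finset.card_erase_of_mem (Finset.mem_univ _), Finset.card_univ,
      Nat.cast_sub Fintype.card_pos, fintypeCard_eq_pow_finrank F K₁, hk₁]
    push_cast; rfl
  have hc : ∀ u v : ℚ, ∑ c : F, (if c = 0 then u else v) = u + ((Fintype.card F : ℚ) - 1) * v := by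
    intro u v
    rw [← Finset.add_sum_erase _ _ (Finset.mem_univ (0 : F)), if_pos rfl,
      Finset.sum_congr rfl (g := fun _ => v) (fun c hc => if_neg (Finset.ne_of_mem_erase hc)),
      Finset.sum_const, Finset.card_erase_of_mem (Finset.mem_univ _), Finset.card_univ,
      nsmul_eq_mul, Nat.cast_sub Fintype.card_pos, Nat.cast_one]
  have h0 : ∑ c : F, g (tableRow F h ((0 : K₁), c)) = g 0 + ((Fintype.card F : ℚ) - 1) * g 1 := by
    rw [← hc]
    refine Finset.sum_congr rfl fun c _ => ?_
    simp only [tableRow, if_true]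
    split_ifs <;> rfl
  have h1 : ∀ b ∈ Finset.univ.erase (0 : K₁), ∑ c : F, g (tableRow F h (b, c))
      = (g 3 + ((Fintype.card F : ℚ) - 1) * g 5) + classIndicator F h b *
        ((g 2 + ((Fintype.card F : ℚ) - 1) * g 4) - (g 3 + ((Fintype.card F : ℚ) - 1) * g 5)) := by
    intro b hb
    have hb0 := Finset.ne_of_mem_erase hb
    simp only [tableRow, if_neg hb0, classIndicator]
    by_cases hcl : b ^ ((Fintype.card K₁ - 1) / (Fintype.card F + 1)) = (-1) ^ h
    · simp only [hcl, if_true]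
      rw [one_mul, add_sub_cancel, ← hc]
      refine Finset.sum_congr rfl fun c _ => ?_
      split_ifs <;> rfl
    · simp only [hcl, if_false]
      rw [zero_mul, add_zero, ← hc]
      refine Finset.sum_congr rfl fun c _ => ?_
      split_ifs <;> rfl
  rw [Fintype.sum_prod_type, ← Finset.add_sum_erase _ _ (Finset.mem_univ (0 : K₁)), h0,
    Finset.sum_congr rfl h1, Finset.sum_add_distrib, Finset.sum_const, nsmul_eq_mul, hcard,
    ← Finset.sum_mul, Fin.sum_univ_six]
  generalize ∑ b ∈ Finset.univ.erase (0 : K₁), classIndicator F h b = A at hA ⊢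
  simp [tableFreq]
  rw [← mul_right_inj' hq1]
  field_simp
  linear_combination ((g 2 + ((Fintype.card F : ℚ) - 1) * g 4)
    - (g 3 + ((Fintype.card F : ℚ) - 1) * g 5)) * hA

theorem weightCount_augmentedCode {k₁ k₂ : ℕ} (hk₁ : Module.finrank F K₁ = 2 * k₁)
    (hk₂ : Module.finrank F K₂ = 2 * k₂) (he : Nat.gcd (2 * k₁) (2 * k₂) = 2)
    (hl : Nat.gcd k₂ (Fintype.card F - 1) = 1) (h3 : 3 ≤ k₁ + k₂) (w : ℕ) :
    (weightCount (augmentedCode F K₁ K₂ L) w : ℚ)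
      = ∑ i : Fin 6, if tableWeight (Fintype.card F) (Module.finrank F L) (2 * k₁) (2 * k₂) i = w
          then tableFreq (Fintype.card F) (2 * k₁) i else 0 := by
  have hset : {c | c ∈ augmentedCode F K₁ K₂ L ∧ hammingNorm c = w}
      = augmentedEncoder F K₁ K₂ L '' ↑(Finset.univ.filter fun p : K₁ × F =>
          hammingNorm (augmentedEncoder F K₁ K₂ L p) = w) := by
    ext c
    constructor
    · rintro ⟨⟨p, rfl⟩, hw⟩
      exact ⟨p, by simpa using hw, rfl⟩
    · rintro ⟨p, hp, rfl⟩
      exact ⟨⟨p, rfl⟩, by simpa using hp⟩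
  rw [weightCount, hset, Set.ncard_image_of_injective _
    (augmentedEncoder_injective hk₁ hk₂ he hl h3), Set.ncard_coe_finset, ← Finset.sum_boole]
  have := sum_tableRow (F := F) hk₁ (k₁ + k₂) (fun i =>
    if tableWeight (Fintype.card F) (Module.finrank F L) (2 * k₁) (2 * k₂) i = w then 1 else 0)
  simp only [mul_ite, mul_one, mul_zero] at this
  rw [← this]
  refine Finset.sum_congr rfl fun p _ => ?_
  refine if_congr ?_ rfl rfl
  rw [← hammingNorm_encoder hk₁ hk₂ he hl p, Nat.cast_inj]

/-- All six frequencies are positive, whereas a missed row would have frequency `0` by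
`sum_tableRow`. -/
theorem tableRow_surjective {k₁ : ℕ} (hk₁ : Module.finrank F K₁ = 2 * k₁) (h : ℕ) :
    Function.Surjective (tableRow F h : K₁ × F → Fin 6) := by
  intro i
  by_contra hi
  push Not at hi
  have hq : (1 : ℚ) < Fintype.card F := by exact_mod_cast Fintype.one_lt_card (α := F)
  have hk0 : 2 * k₁ ≠ 0 := by rw [← hk₁]; exact (Module.finrank_pos).ne'
  have hp : 0 < (Fintype.card F : ℚ) ^ (2 * k₁) - 1 := sub_pos.2 (one_lt_pow₀ hq hk0)
  have hp' : 0 < (Fintype.card F : ℚ) - 1 := sub_pos.2 hq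
  have hs := sum_tableRow (F := F) hk₁ h (fun j => if j = i then 1 else 0)
  simp only [hi, if_false, Finset.sum_const_zero, mul_ite, mul_one, mul_zero,
    Finset.sum_ite_eq', Finset.mem_univ, if_true] at hs
  have : 0 < tableFreq (Fintype.card F) (2 * k₁) i := by
    have hq0 : 0 < (Fintype.card F : ℚ) := one_pos.trans hq
    have hq1 : 0 < (Fintype.card F : ℚ) + 1 := by positivity
    fin_cases i
    · exact one_pos
    · exact hp'
    · exact div_pos hp hq1
    · exact div_pos (mul_pos hq0 hp) hq1
    · exact div_pos (mul_pos hp hp') hq1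
    · exact div_pos (mul_pos (mul_pos hq0 hp) hp') hq1
  exact this.ne hs

/-- To be read with `u = V₁`, `v = V₀` and primes for multiplication by `q - 1`; for `q = 2` the
primed and unprimed values agree, hence the weak inequalities. -/
theorem vec_six_injective {n u v u' v' : ℚ} (hu : u' < n) (hv : v' < n) (hu' : u ≤ u')
    (hv' : v ≤ v') (u0 : 0 < u) (v0 : 0 < v) (huv : u ≠ v) (huv' : u' ≠ v') (d11 : u' + u ≠ n)
    (d10 : u' + v ≠ n) (d01 : v' + u ≠ n) (d00 : v' + v ≠ n) :
    Function.Injective ![0, n, u', v', n - u, n - v] := by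
  have sep : ∀ i j : Fin 6, i < j →
      ![0, n, u', v', n - u, n - v] i ≠ ![0, n, u', v', n - u, n - v] j := by
    intro i j hij h
    fin_cases i <;> fin_cases j <;> simp at hij <;> simp at h <;>
      first
        | linarith
        | exact huv' h
        | exact huv h
        | exact d11 (by linarith)
        | exact d10 (by linarith)
        | exact d01 (by linarith)
        | exact d00 (by linarith)
  intro i j h
  rcases lt_trichotomy i j with hij | hij | hij
  · exact absurd h (sep i j hij)
  · exact hij
  · exact absurd h.symm (sep j i hij)

variable [IsScalarTower F K₂ L]

theorem tableWeight_injective {k₁ k₂ : ℕ} (hk₁ : Module.finrank F K₁ = 2 * k₁)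
    (hk₂ : Module.finrank F K₂ = 2 * k₂) (he : Nat.gcd (2 * k₁) (2 * k₂) = 2)
    (hl : Nat.gcd k₂ (Fintype.card F - 1) = 1) (h3 : 3 ≤ k₁ + k₂)
    (hm4 : Module.finrank F L ≠ 4) :
    Function.Injective
      (tableWeight (Fintype.card F) (Module.finrank F L) (2 * k₁) (2 * k₂)) := by
  have hq1 : 1 < Fintype.card F := Fintype.one_lt_card
  have hq : (1 : ℚ) < Fintype.card F := by exact_mod_cast hq1
  have hk₁0 : 2 * k₁ ≠ 0 := by rw [← hk₁]; exact (Module.finrank_pos).ne'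
  have hk₂0 : 2 * k₂ ≠ 0 := by rw [← hk₂]; exact (Module.finrank_pos).ne'
  have hm0 : Module.finrank F L ≠ 0 := (Module.finrank_pos).ne'
  have hd₁ : 2 * k₁ ∣ Module.finrank F L :=
    ⟨_, by rw [← hk₁, Module.finrank_mul_finrank F K₁ L]⟩
  have hd₂ : 2 * k₂ ∣ Module.finrank F L :=
    ⟨_, by rw [← hk₂, Module.finrank_mul_finrank F K₂ L]⟩
  have hne := traceFiberSize_one_ne_traceFiberSize_zero hq (m := Module.finrank F L) (k₁ := k₁) (k₂ := k₂) hm0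
    (by omega) (by omega)
  have hpos : ∀ A : ℚ, A = 0 ∨ A = 1 → 0 < traceFiberSize (Fintype.card F) (Module.finrank F L)
    k₁ k₂ A := fun A hA => traceFiberSize_pos hq hm0 (by omega) (by omega) h3 hA
  have hdist : ∀ A B : ℚ, A = 0 ∨ A = 1 → B = 0 ∨ B = 1 → _ := fun A B hA hB =>
    mul_traceFiberSize_add_ne hq1 hm0 (k₁ := k₁) (k₂ := k₂) (by omega) (by omega) he hd₁ hd₂ hm4
      h3 hA hB
  have hn : ∀ b : K₁, b ≠ 0 → ((Fintype.card F : ℚ) - 1) * traceFiberSize (Fintype.card F)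
      (Module.finrank F L) k₁ k₂ (classIndicator F (k₁ + k₂) b)
      < codeLength (Fintype.card F) (Module.finrank F L) (2 * k₂) := by
    intro b hb
    have hs := traceCount_zero_add (L := L) hk₁ hk₂ he hl hb
    rw [card_definingSet hk₂] at hs
    have : (0 : ℚ) < traceCount K₂ L b (0 : F) :=
      Nat.cast_pos.2 (traceCount_zero_pos b)
    linarith
  -- Rows `2` and `3` supply a nonzero `b` in each class, so that the strict bound by `n` holds for
  -- both fibre sizes.
  obtain ⟨⟨b₁, c₁⟩, hb₁⟩ := tableRow_surjective (F := F) hk₁ (k₁ + k₂) 2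
  obtain ⟨⟨b₀, c₀⟩, hb₀⟩ := tableRow_surjective (F := F) hk₁ (k₁ + k₂) 3
  have hn₁ : ((Fintype.card F : ℚ) - 1) * traceFiberSize (Fintype.card F)
      (Module.finrank F L) k₁ k₂ 1 < codeLength (Fintype.card F) (Module.finrank F L) (2 * k₂) := by
    unfold tableRow at hb₁
    split_ifs at hb₁ with h1 h2 h3' h4 <;> try simp at hb₁
    have := hn b₁ h1
    rwa [classIndicator, if_pos h3'] at this
  have hn₀ : ((Fintype.card F : ℚ) - 1) * traceFiberSize (Fintype.card F)
      (Module.finrank F L) k₁ k₂ 0 < codeLength (Fintype.card F) (Module.finrank F L) (2 * k₂) := by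
    unfold tableRow at hb₀
    split_ifs at hb₀ with h1 h2 h3' h4 <;> try simp at hb₀
    have := hn b₀ h1
    rwa [classIndicator, if_neg h3'] at this
  rw [tableWeight_eq hq _ (by omega) (by omega)]
  have hqp : 0 < (Fintype.card F : ℚ) - 1 := sub_pos.2 hq
  have hqp1 : 1 ≤ (Fintype.card F : ℚ) - 1 := by
    have : (2 : ℚ) ≤ Fintype.card F := by exact_mod_cast hq1
    linarith
  have p1 := hpos 1 (Or.inr rfl)
  have p0 := hpos 0 (Or.inl rfl)
  have d11 := hdist 1 1 (Or.inr rfl) (Or.inr rfl)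
  have d10 := hdist 1 0 (Or.inr rfl) (Or.inl rfl)
  have d01 := hdist 0 1 (Or.inl rfl) (Or.inr rfl)
  have d00 := hdist 0 0 (Or.inl rfl) (Or.inl rfl)
  refine vec_six_injective hn₁ hn₀ ?_ ?_ p1 p0 hne (fun h => hne (mul_left_cancel₀ hqp.ne' h))
    d11 d10 d01 d00
  · exact le_mul_of_one_le_left p1.le hqp1
  · exact le_mul_of_one_le_left p0.le hqp1

theorem isWeightCode_five {k₁ k₂ : ℕ} (hk₁ : Module.finrank F K₁ = 2 * k₁)
    (hk₂ : Module.finrank F K₂ = 2 * k₂) (he : Nat.gcd (2 * k₁) (2 * k₂) = 2)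
    (hl : Nat.gcd k₂ (Fintype.card F - 1) = 1) (h3 : 3 ≤ k₁ + k₂)
    (hm4 : Module.finrank F L ≠ 4) : IsWeightCode (augmentedCode F K₁ K₂ L) 5 := by
  have hinj := tableWeight_injective (L := L) hk₁ hk₂ he hl h3 hm4
  have hwt := hammingNorm_encoder (L := L) hk₁ hk₂ he hl
  -- One representative per row: the nonzero weights are exactly those of the five rows other than
  -- `0`.
  choose s hs using tableRow_surjective (F := F) hk₁ (k₁ + k₂)
  have hset : {w : ℕ | w ≠ 0 ∧ weightCount (augmentedCode F K₁ K₂ L) w ≠ 0}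
      = (fun i => hammingNorm (augmentedEncoder F K₁ K₂ L (s i))) ''
          ↑(Finset.univ.erase (0 : Fin 6)) := by
    ext w
    have hcount : weightCount (augmentedCode F K₁ K₂ L) w ≠ 0
        ↔ ∃ p, hammingNorm (augmentedEncoder F K₁ K₂ L p) = w := by
      rw [weightCount, ← Nat.pos_iff_ne_zero, Set.ncard_pos (Set.toFinite _)]
      constructor
      · rintro ⟨_, ⟨p, rfl⟩, hp⟩; exact ⟨p, hp⟩
      · rintro ⟨p, hp⟩; exact ⟨_, ⟨p, rfl⟩, hp⟩
    have hW : ∀ p, hammingNorm (augmentedEncoder F K₁ K₂ L p)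
        = hammingNorm (augmentedEncoder F K₁ K₂ L (s (tableRow F (k₁ + k₂) p))) := by
      intro p
      have : (hammingNorm (augmentedEncoder F K₁ K₂ L p) : ℚ)
        = hammingNorm (augmentedEncoder F K₁ K₂ L (s (tableRow F (k₁ + k₂) p))) := by
        rw [hwt, hwt, hs]
      exact_mod_cast this
    have hW0 : ∀ i, hammingNorm (augmentedEncoder F K₁ K₂ L (s i)) = 0 ↔ i = 0 := by
      intro i
      rw [← hinj.eq_iff, ← hs i, ← hwt, hs]
      simp [tableWeight]
    rw [Set.mem_ofPred_eq, hcount]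
    constructor
    · rintro ⟨hw, p, rfl⟩
      refine ⟨tableRow F (k₁ + k₂) p, ?_, (hW p).symm⟩
      simp only [Finset.coe_erase, Finset.coe_univ, Set.mem_sdiff, Set.mem_univ, true_and,
        Set.mem_singleton_iff]
      rw [← hW0, ← hW]
      exact hw
    · rintro ⟨i, hi, rfl⟩
      refine ⟨fun h => ?_, s i, rfl⟩
      have := (hW0 i).1 h
      simp [this] at hi
  have hWinj : Function.Injective (fun i => hammingNorm (augmentedEncoder F K₁ K₂ L (s i))) := by
    intro i j hij
    apply hinj
    rw [← hs i, ← hs j, ← hwt, ← hwt]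
    exact_mod_cast hij
  rw [IsWeightCode, hset, Set.ncard_image_of_injective _ hWinj, Set.ncard_coe_finset]
  rfl

end Weights

/-! ## Divisibility and self-orthogonality -/

theorem dvd_of_eq_codeLength {q m k₂ n : ℕ} (hq : 1 < q) (hm : m ≠ 0) (hk₂ : k₂ ≠ 0)
    (h : (n : ℚ) = codeLength q m (2 * k₂)) : q ∣ n := by
  obtain ⟨b, rfl⟩ := Nat.exists_eq_succ_of_ne_zero hk₂
  obtain ⟨m, rfl⟩ := Nat.exists_eq_succ_of_ne_zero hm
  simp only [Nat.succ_eq_add_one] at h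
  have hqq : (1 : ℚ) < q := by exact_mod_cast hq
  have hq0 : (q : ℚ) ≠ 0 := by positivity
  have hb : (q : ℚ) ^ (2 * (b + 1)) - 1 ≠ 0 := (sub_pos.2 (one_lt_pow₀ hqq (by omega))).ne'
  -- The cleared equation is `(n - 1) * (q ^ m₂ - 1) = (q ^ m - 1) * (q ^ (m₂ - 1) - 1)`, which
  -- reads `-(n - 1) ≡ 1` modulo `q`; here the multiple of `q` is written out. The exponent of the
  -- ambient field is now `m + 1`.
  have key : (n : ℚ) = q * ((q : ℚ) ^ (2 * b + 1) * (n - 1) - (q ^ m * q ^ (2 * b + 1))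
      + q ^ m + q ^ (2 * b)) := by
    unfold codeLength at h
    rw [← sub_eq_iff_eq_add, eq_div_iff (mul_ne_zero hq0 hb)] at h
    apply mul_left_cancel₀ hq0
    linear_combination -h
  have key' : (n : ℤ) = q * ((q : ℤ) ^ (2 * b + 1) * (n - 1) - (q ^ m * q ^ (2 * b + 1))
      + q ^ m + q ^ (2 * b)) := by exact_mod_cast key
  exact Int.natCast_dvd_natCast.1 ⟨_, key'⟩

theorem dvd_of_eq_traceFiberSize {q m k₁ k₂ V : ℕ} (hq : 1 < q) (hk₁ : k₁ ≠ 0)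
    (hk₂ : k₂ ≠ 0) (h3 : 3 ≤ k₁ + k₂) {A : ℚ} (hA : A = 0 ∨ A = 1)
    (h : (V : ℚ) = traceFiberSize q m k₁ k₂ A) : q ∣ V := by
  obtain ⟨a, rfl⟩ := Nat.exists_eq_succ_of_ne_zero hk₁
  obtain ⟨b, rfl⟩ := Nat.exists_eq_succ_of_ne_zero hk₂
  simp only [Nat.succ_eq_add_one] at h h3
  -- Now `q ^ (k₁ + k₂) = q ^ (c + 3)` retains a factor `q` after the `q ^ 2` in the denominator is
  -- cancelled; the other denominators are prime to `q`.
  obtain ⟨c, hc⟩ : ∃ c, a + b = c + 1 := ⟨a + b - 1, by omega⟩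
  have hc' : a + 1 + (b + 1) = c + 3 := by omega
  obtain ⟨T, rfl⟩ : ∃ T : ℤ, A = T := by
    rcases hA with rfl | rfl
    · exact ⟨0, by simp⟩
    · exact ⟨1, by simp⟩
  have hqq : (1 : ℚ) < q := by exact_mod_cast hq
  have hq0 : (q : ℚ) ≠ 0 := by positivity
  have ha : (q : ℚ) ^ (2 * (a + 1)) - 1 ≠ 0 := (sub_pos.2 (one_lt_pow₀ hqq (by omega))).ne'
  have hb : (q : ℚ) ^ (2 * (b + 1)) - 1 ≠ 0 := (sub_pos.2 (one_lt_pow₀ hqq (by omega))).ne'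
  have key : (V : ℚ) = q * (((q : ℚ) ^ m - 1) * (q ^ (2 * a) * (q ^ (2 * b + 1) - 1)
      - (q - 1) * (-1) ^ (c + 3) * q ^ c * ((q + 1) * T - 1))
      - V * (q ^ (2 * a + 1) * q ^ (2 * b + 2) - q ^ (2 * a + 1) - q ^ (2 * b + 1))) := by
    unfold traceFiberSize at h
    rw [eq_div_iff (mul_ne_zero (mul_ne_zero (pow_ne_zero 2 hq0) ha) hb), hc'] at h
    apply mul_left_cancel₀ (pow_ne_zero 2 hq0)
    linear_combination h
  have key' : (V : ℤ) = q * (((q : ℤ) ^ m - 1) * (q ^ (2 * a) * (q ^ (2 * b + 1) - 1)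
      - (q - 1) * (-1) ^ (c + 3) * q ^ c * ((q + 1) * T - 1))
      - V * (q ^ (2 * a + 1) * q ^ (2 * b + 2) - q ^ (2 * a + 1) - q ^ (2 * b + 1))) := by
    exact_mod_cast key
  exact Int.natCast_dvd_natCast.1 ⟨_, key'⟩

section Divisible

variable {F K₁ K₂ L : Type*} [Field F] [Fintype F] [DecidableEq F] [Field K₁] [Fintype K₁]
  [DecidableEq K₁] [Field K₂] [Fintype K₂] [Field L] [Fintype L] [Algebra F K₁] [Algebra F K₂]
  [Algebra F L] [Algebra K₁ L] [Algebra K₂ L] [IsScalarTower F K₁ L]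

theorem card_dvd_traceCount {k₁ k₂ : ℕ} (hk₁ : Module.finrank F K₁ = 2 * k₁)
    (hk₂ : Module.finrank F K₂ = 2 * k₂) (he : Nat.gcd (2 * k₁) (2 * k₂) = 2)
    (hl : Nat.gcd k₂ (Fintype.card F - 1) = 1) (h3 : 3 ≤ k₁ + k₂) (b : K₁) (t : F) :
    Fintype.card F ∣ Fintype.card (definingSet F K₂ L) ∧
      Fintype.card F ∣ traceCount K₂ L b t := by
  have hq : 1 < Fintype.card F := Fintype.one_lt_card
  have hk₁0 : 2 * k₁ ≠ 0 := by rw [← hk₁]; exact (Module.finrank_pos).ne'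
  have hk₂0 : 2 * k₂ ≠ 0 := by rw [← hk₂]; exact (Module.finrank_pos).ne'
  have hn : Fintype.card F ∣ Fintype.card (definingSet F K₂ L) :=
    dvd_of_eq_codeLength hq (Module.finrank_pos (R := F) (M := L)).ne' (by omega)
      (card_definingSet hk₂)
  refine ⟨hn, ?_⟩
  by_cases hb : b = 0
  · subst hb
    by_cases ht : t = 0
    · have : traceCount K₂ L (0 : K₁) t = Fintype.card (definingSet F K₂ L) := by
        rw [traceCount, ht]; simp
      rwa [this]
    · have : traceCount K₂ L (0 : K₁) t = 0 := by
        simp [traceCount, Ne.symm ht]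
      rw [this]
      exact dvd_zero _
  · have hV : ∀ s : F, s ≠ 0 → Fintype.card F ∣ traceCount K₂ L b s := fun s hs =>
      dvd_of_eq_traceFiberSize hq (by omega) (by omega) h3
        (classIndicator_eq_or F (k₁ + k₂) b) (traceCount_eq hk₁ hk₂ he hl hb hs)
    by_cases ht : t = 0
    · subst ht
      have hs := sum_traceCount (F := F) (K₂ := K₂) (L := L) b
      rw [← Finset.add_sum_erase _ _ (Finset.mem_univ (0 : F))] at hs
      rw [← hs] at hn
      exact (Nat.dvd_add_left (Finset.dvd_sum fun s hs => hV s (Finset.ne_of_mem_erase hs))).1 hn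
    · exact hV t ht

theorem isDivisibleCode_augmentedCode {k₁ k₂ : ℕ} (hk₁ : Module.finrank F K₁ = 2 * k₁)
    (hk₂ : Module.finrank F K₂ = 2 * k₂) (he : Nat.gcd (2 * k₁) (2 * k₂) = 2)
    (hl : Nat.gcd k₂ (Fintype.card F - 1) = 1) (h3 : 3 ≤ k₁ + k₂) :
    IsDivisibleCode (augmentedCode F K₁ K₂ L) (Fintype.card F) := by
  refine ⟨Fintype.one_lt_card, ?_⟩
  rintro _ ⟨⟨b, c⟩, rfl⟩
  have h := card_dvd_traceCount (L := L) hk₁ hk₂ he hl h3 b (-c)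
  rw [← hammingNorm_encoder_add b c] at h
  exact (Nat.dvd_add_left h.2).1 h.1

/-- In `∑ u x ^ 2` each value occurs a multiple of `q` times, so the sum vanishes in `F`.
Polarisation then gives `2 * ∑ u x * v x = 0`, and `2` is invertible. -/
theorem isSelfOrthogonalCode_augmentedCode {k₁ k₂ : ℕ} (hk₁ : Module.finrank F K₁ = 2 * k₁)
    (hk₂ : Module.finrank F K₂ = 2 * k₂) (he : Nat.gcd (2 * k₁) (2 * k₂) = 2)
    (hl : Nat.gcd k₂ (Fintype.card F - 1) = 1) (h3 : 3 ≤ k₁ + k₂) (hodd : Odd (Fintype.card F)) :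
    IsSelfOrthogonalCode (augmentedCode F K₁ K₂ L) := by
  have hsq : ∀ u ∈ augmentedCode F K₁ K₂ L, ∑ x, u x * u x = 0 := by
    rintro _ ⟨⟨b, c⟩, rfl⟩
    rw [← Finset.sum_fiberwise_of_maps_to (s := Finset.univ) (t := Finset.univ)
      (g := fun x : definingSet F K₂ L => Algebra.trace F K₁ (b * Algebra.norm K₁ (x : L)))
      (fun _ _ => Finset.mem_univ _)]
    refine Finset.sum_eq_zero fun t _ => ?_
    rw [Finset.sum_congr rfl (g := fun _ => (t + c) * (t + c)), Finset.sum_const]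
    · obtain ⟨r, hr⟩ := (card_dvd_traceCount (L := L) hk₁ hk₂ he hl h3 b t).2
      rw [traceCount] at hr
      rw [hr, nsmul_eq_mul, Nat.cast_mul, FiniteField.cast_card_eq_zero, zero_mul, zero_mul]
    · intro x hx
      rw [augmentedEncoder_apply, (Finset.mem_filter.1 hx).2]
  have h2 : (2 : F) ≠ 0 := by
    intro h2
    obtain ⟨r, hr⟩ := hodd
    have := FiniteField.cast_card_eq_zero F
    rw [hr, Nat.cast_add, Nat.cast_mul, Nat.cast_ofNat, h2] at this
    simp at this
  intro u hu v hv
  have huv := hsq _ ((augmentedCode F K₁ K₂ L).add_mem hu hv)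
  have hexp : ∑ x, (u + v) x * (u + v) x
      = ∑ x, u x * u x + 2 * ∑ x, u x * v x + ∑ x, v x * v x := by
    rw [Finset.mul_sum, ← Finset.sum_add_distrib, ← Finset.sum_add_distrib]
    refine Finset.sum_congr rfl fun x _ => ?_
    simp only [Pi.add_apply]; ring
  rw [hexp, hsq u hu, hsq v hv, zero_add, add_zero] at huv
  exact (mul_eq_zero.1 huv).resolve_left h2

end Divisible

/-! ## The dual code -/

section Dual

variable {F K₁ K₂ L : Type*} [Field F] [DecidableEq F] [Field K₁] [Field K₂] [Field L] [Fintype L]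
  [Algebra F K₁] [Algebra F K₂] [Algebra F L] [Algebra K₁ L] [Algebra K₂ L]
  [IsScalarTower F K₁ L]

/-- If `K₁ = L`, the dual code consists of the affine dependencies of the points of `D`. -/
theorem mem_dualCode_augmentedCode_iff (h1 : Module.finrank K₁ L = 1)
    {u : definingSet F K₂ L → F} :
    u ∈ dualCode (augmentedCode F K₁ K₂ L) ↔ ∑ x, u x = 0 ∧ ∑ x, u x • (x : L) = 0 := by
  have : Finite K₁ := Finite.of_injective _ (algebraMap K₁ L).injective
  have : Finite F := Finite.of_injective _ (algebraMap F L).injective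
  have hnorm : ∀ x : L, algebraMap K₁ L (Algebra.norm K₁ x) = x := fun x => by
    rw [FiniteField.algebraMap_norm_eq_pow_sum, h1]; simp
  have hmap : algebraMap K₁ L (∑ x, u x • Algebra.norm K₁ (x : L)) = ∑ x, u x • (x : L) := by
    rw [map_sum]
    refine Finset.sum_congr rfl fun x _ => ?_
    rw [Algebra.smul_def, map_mul, hnorm, ← IsScalarTower.algebraMap_apply, ← Algebra.smul_def]
  -- The pairing separates into the trace form against `∑ u x • x` and a multiple of `∑ u x`;
  -- nondegeneracy of the trace form then forces both to vanish.
  have hpair : ∀ b c, ∑ x, u x * augmentedEncoder F K₁ K₂ L (b, c) x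
      = Algebra.trace F K₁ (b * ∑ x, u x • Algebra.norm K₁ (x : L)) + (∑ x, u x) * c := by
    intro b c
    rw [Finset.mul_sum, map_sum, Finset.sum_mul, ← Finset.sum_add_distrib]
    refine Finset.sum_congr rfl fun x _ => ?_
    rw [augmentedEncoder_apply, mul_smul_comm, map_smul, smul_eq_mul, mul_add]
  rw [← hmap, map_eq_zero_iff _ (algebraMap K₁ L).injective]
  constructor
  · intro hu
    have hu' : ∀ b c, Algebra.trace F K₁ (b * ∑ x, u x • Algebra.norm K₁ (x : L))
        + (∑ x, u x) * c = 0 := fun b c => by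
      rw [← hpair]; exact hu _ ⟨(b, c), rfl⟩
    refine ⟨by simpa using hu' 0 1, ?_⟩
    refine (traceForm_nondegenerate F K₁).1 _ fun b => ?_
    rw [Algebra.traceForm_apply, mul_comm]
    simpa using hu' b 0
  · rintro ⟨h0, h0'⟩ _ ⟨⟨b, c⟩, rfl⟩
    rw [hpair, h0, h0']; simp

/-- Distinct points are affinely independent in pairs, so no affine dependency is supported on one
or two of them. -/
theorem three_le_hammingNorm_of_mem_dualCode (h1 : Module.finrank K₁ L = 1)
    {u : definingSet F K₂ L → F} (hu : u ∈ dualCode (augmentedCode F K₁ K₂ L)) (hu0 : u ≠ 0) :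
    3 ≤ hammingNorm u := by
  classical
  rw [mem_dualCode_augmentedCode_iff h1] at hu
  obtain ⟨i, hi⟩ := Function.ne_iff.1 hu0
  rw [Pi.zero_apply] at hi
  obtain ⟨j, hji, hj⟩ : ∃ j, j ≠ i ∧ u j ≠ 0 := by
    by_contra hno
    push Not at hno
    have := hu.1
    rw [Finset.sum_eq_single i (fun j _ hji => hno j hji) (by simp)] at this
    exact hi this
  by_contra hlt
  have hsupp : ∀ x, x ∉ ({i, j} : Finset (definingSet F K₂ L)) → u x = 0 := by
    intro x hx
    by_contra hx0
    have hsub : insert x {i, j} ⊆ Finset.univ.filter fun y => u y ≠ 0 := by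
      intro y hy
      simp only [Finset.mem_insert, Finset.mem_singleton] at hy
      rcases hy with rfl | rfl | rfl <;> simpa
    have hc := Finset.card_le_card hsub
    rw [Finset.card_insert_of_notMem hx, Finset.card_pair hji.symm] at hc
    exact hlt hc
  have e1 : u i + u j = 0 := by
    rw [← Finset.sum_pair hji.symm, ← hu.1]
    exact Finset.sum_subset (Finset.subset_univ _) fun x _ hx => hsupp x hx
  have e2 : u i • (i : L) + u j • (j : L) = 0 := by
    rw [← Finset.sum_pair (f := fun x : definingSet F K₂ L => u x • (x : L)) hji.symm, ← hu.2]
    exact Finset.sum_subset (Finset.subset_univ _) fun x _ hx => by rw [hsupp x hx, zero_smul]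
  rw [eq_neg_of_add_eq_zero_right e1, neg_smul, ← sub_eq_add_neg, ← smul_sub] at e2
  exact hji (Subtype.ext (sub_eq_zero.1 ((smul_eq_zero.1 e2).resolve_left hi)).symm)

theorem smul_mem_definingSet [IsScalarTower F K₂ L] (a : F) {x : L}
    (hx : x ∈ definingSet F K₂ L) : a • x ∈ definingSet F K₂ L := by
  rw [mem_definingSet] at hx ⊢
  rw [← algebraMap_smul K₂ a x, Algebra.smul_def, map_mul, Algebra.norm_algebraMap, ← map_pow,
    ← Algebra.smul_def, map_smul, hx, smul_zero]

/-- For `a ∉ {0, 1}` the points `0`, `x`, `a • x` of `D` are distinct and collinear, with affine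
dependency `(a - 1, -a, 1)`. -/
theorem hasMinDist_dualCode_three [IsScalarTower F K₂ L] (h1 : Module.finrank K₁ L = 1)
    (hq : 2 < Nat.card F) {x : L} (hx : x ∈ definingSet F K₂ L) (hx0 : x ≠ 0) :
    HasMinDist (dualCode (augmentedCode F K₁ K₂ L)) 3 := by
  classical
  have : Finite F := Finite.of_injective _ (algebraMap F L).injective
  have := Fintype.ofFinite F
  rw [Nat.card_eq_fintype_card] at hq
  obtain ⟨a, -, ha⟩ := Finset.exists_mem_notMem_of_card_lt_card
    (s := ({0, 1} : Finset F)) (t := Finset.univ)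
    (by rw [Finset.card_univ]; exact Finset.card_le_two.trans_lt hq)
  simp only [Finset.mem_insert, Finset.mem_singleton, not_or] at ha
  set p₀ : definingSet F K₂ L := ⟨0, zero_mem_definingSet⟩ with hp₀
  set p₁ : definingSet F K₂ L := ⟨x, hx⟩ with hp₁
  set p₂ : definingSet F K₂ L := ⟨a • x, smul_mem_definingSet a hx⟩ with hp₂
  have h20 : p₂ ≠ p₀ := fun h => smul_ne_zero ha.1 hx0 (congrArg Subtype.val h)
  have h21 : p₂ ≠ p₁ := fun h => ha.2 (by
    have : a • x = (1 : F) • x := (congrArg Subtype.val h).trans (one_smul F x).symm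
    exact smul_left_injective F hx0 this)
  set u : definingSet F K₂ L → F :=
    Pi.single p₀ (a - 1) + Pi.single p₁ (-a) + Pi.single p₂ 1 with hu
  have hsum : ∀ (p : definingSet F K₂ L) (r : F),
      ∑ y, (Pi.single p r : definingSet F K₂ L → F) y • (y : L) = r • (p : L) := by
    intro p r
    rw [Finset.sum_eq_single p (fun y _ hy => by rw [Pi.single_eq_of_ne hy, zero_smul]) (by simp),
      Pi.single_eq_same]
  refine hasMinDist_of_weights (u := u) ?_ ?_ ?_
    (fun v hv hv0 => three_le_hammingNorm_of_mem_dualCode h1 hv hv0)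
  · rw [mem_dualCode_augmentedCode_iff h1]
    constructor
    · simp only [hu, Pi.add_apply, Finset.sum_add_distrib, Finset.sum_pi_single', Finset.mem_univ,
        if_true]
      ring
    · simp only [hu, Pi.add_apply, add_smul, Finset.sum_add_distrib, hsum]
      simp [hp₀, hp₁, hp₂]
  · intro h0
    have := congrFun h0 p₂
    simp [hu, h20, h21] at this
  · have e1 := hammingNorm_add_le (Pi.single p₀ (a - 1) + Pi.single p₁ (-a)) (Pi.single p₂ (1 : F))
    have e2 := hammingNorm_add_le (Pi.single p₀ (a - 1)) (Pi.single p₁ (-a))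
    have e3 := hammingNorm_single_le p₀ (a - 1)
    have e4 := hammingNorm_single_le p₁ (-a)
    have e5 := hammingNorm_single_le p₂ (1 : F)
    rw [← hu] at e1
    omega

/-- The dual code is the kernel of a linear map into `F × L`, a space of dimension `m + 1`. -/
theorem finrank_dualCode_ge (h1 : Module.finrank K₁ L = 1) :
    Fintype.card (definingSet F K₂ L)
      ≤ Module.finrank F (dualCode (augmentedCode F K₁ K₂ L)) + (Module.finrank F L + 1) := by
  let T : (definingSet F K₂ L → F) →ₗ[F] F × L :=
    LinearMap.prod (∑ x, LinearMap.proj x) (∑ x : definingSet F K₂ L, (LinearMap.proj x).smulRight (x : L))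
  have hT : LinearMap.ker T = dualCode (augmentedCode F K₁ K₂ L) := by
    ext u
    rw [mem_dualCode_augmentedCode_iff h1, LinearMap.mem_ker]
    simp [T, Prod.ext_iff]
  have h := T.finrank_range_add_finrank_ker
  have h' := Submodule.finrank_le (LinearMap.range T)
  rw [Module.finrank_prod, Module.finrank_self] at h'
  rw [Module.finrank_fintype_fun_eq_card, hT] at h
  omega

/-- Over two elements the coordinate sum is the weight modulo `2`. -/
theorem hammingNorm_ne_three_of_card_two {ι : Type*} [Fintype ι] (hq : Nat.card F = 2)
    {u : ι → F} (hu : ∑ x, u x = 0) : hammingNorm u ≠ 3 := by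
  have : Finite F := Nat.finite_of_card_ne_zero (by omega)
  have := Fintype.ofFinite F
  rw [Nat.card_eq_fintype_card] at hq
  intro h
  have h2 := FiniteField.cast_card_eq_zero F
  rw [hq] at h2
  have hsum : ∑ x, u x = (hammingNorm u : F) := by
    rw [hammingNorm, ← Finset.sum_boole]
    refine Finset.sum_congr rfl fun x _ => ?_
    split_ifs with hx
    · simpa [hq] using FiniteField.pow_card_sub_one_eq_one (u x) hx
    · exact not_not.1 hx
  rw [hu, h, show (3 : ℕ) = 2 + 1 by norm_num, Nat.cast_add, h2] at hsum
  simp at hsum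

/-- The bound would give `1 + n + n.choose 2 ≤ 2 ^ (m + 1)`, but the left side is quadratic in `n`,
with `n` about `2 ^ m / 3`. -/
theorem not_spherePackingBound_five {n k m : ℕ} (hm : 6 ≤ m) (hn : 3 * n = 2 ^ m + 2)
    (hk : n ≤ k + (m + 1)) : ¬ SpherePackingBound 2 n k 5 := by
  intro h
  have hs : ∑ i ∈ Finset.range ((5 - 1) / 2 + 1), n.choose i * (2 - 1) ^ i
      = 1 + n + n.choose 2 := by
    simp [Finset.sum_range_succ]
  rw [SpherePackingBound, hs] at h
  have h1 : 2 ^ k * (1 + n + n.choose 2) ≤ 2 ^ k * 2 ^ (m + 1) := by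
    rw [← pow_add]; exact h.trans (Nat.pow_le_pow_right (by norm_num) hk)
  have h2 := Nat.le_of_mul_le_mul_left h1 (by positivity)
  have h3 : 2 * n.choose 2 = n * (n - 1) := by
    rw [Nat.choose_two_right, Nat.mul_div_cancel' (Nat.even_mul_pred_self n).two_dvd]
  have h4 : 2 ^ 6 ≤ 2 ^ m := Nat.pow_le_pow_right (by norm_num) hm
  rw [pow_succ] at h2
  obtain ⟨l, rfl⟩ : ∃ l, n = l + 1 := ⟨n - 1, by omega⟩
  rw [Nat.add_sub_cancel] at h3
  have h5 : 2 ^ m = 3 * l + 1 := by omega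
  rw [h5] at h2 h4
  nlinarith

theorem dualCode_binary (h1 : Module.finrank K₁ L = 1) (hq : Nat.card F = 2)
    (hm : 6 ≤ Module.finrank F L)
    (hn : 3 * Fintype.card (definingSet F K₂ L) = 2 ^ Module.finrank F L + 2) :
    HasMinDist (dualCode (augmentedCode F K₁ K₂ L)) 4 ∧
      IsSpherePackingDistanceOptimal (dualCode (augmentedCode F K₁ K₂ L)) := by
  have : Finite F := Nat.finite_of_card_ne_zero (by omega)
  have := Fintype.ofFinite F
  have hqF : Fintype.card F = 2 := by rw [← hq, Nat.card_eq_fintype_card]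
  have hviol := not_spherePackingBound_five hm hn (finrank_dualCode_ge (K₁ := K₁) h1)
  have hmin : HasMinDist (dualCode (augmentedCode F K₁ K₂ L)) 4 := by
    have h4 : ∀ v ∈ dualCode (augmentedCode F K₁ K₂ L), v ≠ 0 → 4 ≤ hammingNorm v := by
      intro v hv hv0
      have a := three_le_hammingNorm_of_mem_dualCode h1 hv hv0
      have b := hammingNorm_ne_three_of_card_two hq ((mem_dualCode_augmentedCode_iff h1).1 hv).1
      omega
    -- No word of weight `4` is exhibited: without one the distance would be at least `5`, against
    -- sphere packing.
    by_contra hno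
    apply hviol
    rw [← hqF]
    refine spherePackingBound_of_le_hammingDist (by norm_num) fun u hu v hv hne => ?_
    rw [hammingDist_eq_hammingNorm]
    have hw := (dualCode (augmentedCode F K₁ K₂ L)).add_mem
      ((dualCode (augmentedCode F K₁ K₂ L)).neg_mem hu) hv
    have hw0 : -u + v ≠ 0 := fun h0 => hne (neg_add_eq_zero.1 h0)
    by_contra hlt
    exact hno (hasMinDist_of_weights hw hw0 (by omega) h4)
  refine ⟨hmin, ⟨4, hmin, ?_⟩, 4, hmin, by rwa [hq]⟩
  rintro ⟨C', hC', hd⟩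
  apply hviol
  rw [← hC', ← hqF]
  exact spherePackingBound_of_le_hammingDist (by norm_num) fun u hu v hv hne =>
    hd.le_hammingDist hu hv hne

end Dual

/-! ### The main theorem -/

theorem theorem5 {F K₁ K₂ L : Type*} [Field F] [DecidableEq F] [Field K₁] [Field K₂] [Field L]
    [Fintype L] [Algebra F K₁] [Algebra F K₂] [Algebra F L] [Algebra K₁ L] [Algebra K₂ L]
    [IsScalarTower F K₁ L] [IsScalarTower F K₂ L]
    (q m m₁ m₂ : ℕ) (hq : Nat.card F = q)
    (hm : Module.finrank F L = m) (hm₁ : Module.finrank F K₁ = m₁)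
    (hm₂ : Module.finrank F K₂ = m₂)
    (he : Nat.gcd m₁ m₂ = 2) (hl : Nat.gcd (m₂ / 2) (q - 1) = 1)
    (hne : (m₁, m₂) ≠ (2, 2)) :
    -- the parameters `[n, m₁ + 1]`
    ((Fintype.card (definingSet F K₂ L) : ℚ)
        = ((q : ℚ) ^ m - 1) * ((q : ℚ) ^ m₂ - q) / (q * ((q : ℚ) ^ m₂ - 1)) + 1) ∧
    Module.finrank F (augmentedCode F K₁ K₂ L) = m₁ + 1 ∧
    -- the weight distribution; frequencies of rows with equal weight are added
    (∀ w : ℕ, (weightCount (augmentedCode F K₁ K₂ L) w : ℚ)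
        = ∑ i : Fin 6, if tableWeight q m m₁ m₂ i = w then tableFreq q m₁ i else 0) ∧
    -- five distinct nonzero weights
    (m ≠ 4 → IsWeightCode (augmentedCode F K₁ K₂ L) 5) ∧
    -- the dual code
    (m = m₁ → m₂ = 2 → 2 < q → HasMinDist (dualCode (augmentedCode F K₁ K₂ L)) 3) ∧
    (m = m₁ → 4 < m₁ → m₂ = 2 → q = 2 →
      HasMinDist (dualCode (augmentedCode F K₁ K₂ L)) 4 ∧
      IsSpherePackingDistanceOptimal (dualCode (augmentedCode F K₁ K₂ L))) ∧
    -- divisibility and self-orthogonality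
    (2 ≤ m₁ → 2 ≤ m₂ → 6 ≤ m₁ + m₂ → Odd q →
      IsDivisibleCode (augmentedCode F K₁ K₂ L) q ∧
      IsSelfOrthogonalCode (augmentedCode F K₁ K₂ L)) := by

  classical
  have : Finite K₁ := Finite.of_injective _ (algebraMap K₁ L).injective
  have : Finite K₂ := Finite.of_injective _ (algebraMap K₂ L).injective
  have : Finite F := Finite.of_injective _ (algebraMap F L).injective
  have := Fintype.ofFinite F
  have := Fintype.ofFinite K₁
  have := Fintype.ofFinite K₂
  rw [Nat.card_eq_fintype_card] at hq
  obtain ⟨k₁, rfl⟩ : 2 ∣ m₁ := he ▸ Nat.gcd_dvd_left m₁ m₂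
  obtain ⟨k₂, rfl⟩ : 2 ∣ m₂ := he ▸ Nat.gcd_dvd_right (2 * k₁) m₂
  subst hq hm
  rw [Nat.mul_div_cancel_left _ (by norm_num)] at hl
  have hk₁0 : 2 * k₁ ≠ 0 := by rw [← hm₁]; exact (Module.finrank_pos).ne'
  have hk₂0 : 2 * k₂ ≠ 0 := by rw [← hm₂]; exact (Module.finrank_pos).ne'
  have h3 : 3 ≤ k₁ + k₂ := by
    by_contra hlt
    exact hne (by rw [show k₁ = 1 by omega, show k₂ = 1 by omega])
  have hinj := augmentedEncoder_injective (L := L) hm₁ hm₂ he hl h3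
  have hfin : ∀ h : Module.finrank F L = 2 * k₁, Module.finrank K₁ L = 1 := fun h => by
    have := Module.finrank_mul_finrank F K₁ L
    rw [h, hm₁] at this
    exact Nat.eq_of_mul_eq_mul_left (Nat.pos_of_ne_zero hk₁0) (this.trans (mul_one _).symm)
  have hq : (1 : ℚ) < Fintype.card F := by exact_mod_cast Fintype.one_lt_card (α := F)
  refine ⟨card_definingSet hm₂, ?_, weightCount_augmentedCode hm₁ hm₂ he hl h3,
    isWeightCode_five hm₁ hm₂ he hl h3, fun h _ hq2 => ?_, fun h h4 h2 hq2 => ?_,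
    fun _ _ _ hodd => ⟨isDivisibleCode_augmentedCode hm₁ hm₂ he hl h3,
      isSelfOrthogonalCode_augmentedCode hm₁ hm₂ he hl h3 hodd⟩⟩
  · rw [augmentedCode, LinearMap.finrank_range_of_inj hinj, Module.finrank_prod, hm₁,
      Module.finrank_self]
  -- A nonzero point of `D` is needed; a point with `Tr (N₁ x) = 1` is one.
  · have hT := traceCount_eq (L := L) hm₁ hm₂ he hl (one_ne_zero (α := K₁)) (one_ne_zero (α := F))
    have hpos := traceFiberSize_pos hq (m := Module.finrank F L)
      (Module.finrank_pos).ne' (by omega) (by omega) h3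
      (classIndicator_eq_or F (k₁ + k₂) (1 : K₁))
    rw [← hT] at hpos
    obtain ⟨x, hx⟩ := Finset.card_pos.1 (Nat.cast_pos.1 hpos)
    have hx1 := (Finset.mem_filter.1 hx).2
    refine hasMinDist_dualCode_three (hfin h) (by rwa [Nat.card_eq_fintype_card]) x.2 fun h0 => ?_
    rw [h0, Algebra.norm_zero, mul_zero, map_zero] at hx1
    exact zero_ne_one hx1
  -- The degree is even and exceeds `4`, hence is at least `6`.
  · refine dualCode_binary (hfin h) (by rwa [Nat.card_eq_fintype_card]) (by omega) ?_
    have hn := card_definingSet (F := F) (L := L) hm₂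
    rw [codeLength, hq2, h2] at hn
    norm_num at hn
    have hn' : (3 * Fintype.card (definingSet F K₂ L) : ℚ) = 2 ^ Module.finrank F L + 2 := by
      rw [Fintype.card_coe, hn]; ring
    exact_mod_cast hn'
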